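/- Let $\mathcal C$ be a small preadditive category with set of objects $\mathcal C_0$; if all objects of $\mathcal C$ are zero objects, assume that $\mathcal C$ has at most one object. An additive contravariant functor $F:\mathcal C\to\mathcal{A}b$ is *free* if there are a family $(A_i)_{i\in I}$ of objects and elements $x_i\in F(A_i)$ such that for every object $A$ and every $x\in F(A)$ there is a unique $(\lambda_i)_{i\in I}\in\bigoplus_{i\in I}\mathcal C(A,A_i)$ with $x=\sum_{i}F(\lambda_i)(x_i)$; freeness of covariant functors is defined in the same way with $\mathcal C(A_i,A)$. Let $\mathcal G=\mathcal C_0\times\mathcal C_0$ be the groupoid in which $(A,B)(B',D)$ is defined iff $B=B'$ and then equals $(A,D)$, and let $R[\mathcal C]=\bigoplus_{A,B}\mathcal C(A,B)$ be the (not necessarily unital) ring of $\mathcal C$, where $fg=f\circ g$ if this composition is possible and $fg=0$ otherwise, $\mathcal G$-graded by $R[\mathcal C]_{(A,B)}=\mathcal C(B,A)$. It is a *pfm ring* if every unital $\mathcal G$-graded right $R[\mathcal C]$-module $M$ has a pseudo-basis, i.e. a family of homogeneous elements $x_i\in M_{(B_i,A_i)}$ that generates $M$ and such that $(a_i)_i\in\bigoplus_i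 I_{A_i}R[\mathcal C]$ and $\sum_i x_ia_i=0$ imply $a_i=0$ for all $i$ (where $I_A$ denotes the identity of $A$). For a ring $R$, not necessarily unital, $\mathrm{fgmod}\text{-}R$ is the category of finitely generated unital ($MR=M$) right $R$-modules. For division rings $D_j$ ($j\in J$), $\prod^f_{j\in J}\mathrm{fgmod}\text{-}D_j$ is the full subcategory of $\prod_{j\in J}\mathrm{fgmod}\text{-}D_j$ of the families $(M_j)_{j\in J}$ with $M_j=0$ for all but finitely many $j$. Isomorphisms of preadditive categories are additive. Then the following are equivalent. 1. All additive contravariant functors $\mathcal C\to\mathcal{A}b$ are free. 2. All additive covariant functors $\mathcal C\to\mathcal{A}b$ are free. 3. $R[\mathcal C]$ is a pfm $\mathcal G$-graded ring. 4. There exist a set $J$, a family $(A_j)_{j\in J}$ of objects of $\mathcal C$, a family $(D_j)_{j\in J}$ of division rings, a map $n:J\times\mathcal C_0\to\mathbb Z_{\ge0}$ with $\sum_{j\in J}n(j,A)<\infty$ for all $A\in\mathcal C_0$, with $n(j,A_j)=1$ and $\mathcal C(A_j,A_j)\cong D_j$ as rings for all $j\in J$, and isomorphisms of additive groups $$\varphi_{(A,B)}:\mathcal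 C(A,B)\to\prod_{j\in J}\mathbb M_{n(j,B)\times n(j,A)}(D_j)\qquad(A,B\in\mathcal C_0)$$ such that $\varphi_{(A,B)}(fg)=\varphi_{(C,B)}(f)\,\varphi_{(A,C)}(g)$ for all $f\in\mathcal C(C,B)$, $g\in\mathcal C(A,C)$. 5. There exists a family $(D_j)_{j\in J}$ of division rings such that $\mathcal C$ is isomorphic to a small full subcategory of $\mathrm{fgmod}\text{-}\bigoplus_{j\in J}D_j$ whose set of objects contains every $D_j$. 6. There exists a family $(D_j)_{j\in J}$ of division rings such that $\mathcal C$ is isomorphic to a small full subcategory of $\prod^f_{j\in J}\mathrm{fgmod}\text{-}D_j$ whose set of objects contains, for every $j$, a copy of $D_j$ (the module $D_j$ in position $j$ and zero modules elsewhere). -/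

import Mathlib

open CategoryTheory CategoryTheory.Limits

universe u

noncomputable section

/-! ### Right modules over rings that need not have a unity -/

/-- A right module structure on the abelian group `M` over the (not necessarily unital) ring `R`:
`act m r` is the product `m r`. It is additive in `m` and in `r`, and `m (r s) = (m r) s`. -/
class RightModule (R : Type*) [NonUnitalRing R] (M : Type*) [AddCommGroup M] where
  act : M →+ R →+ M
  act_mul : ∀ (m : M) (r s : R), act m (r * s) = act (act m r) s

namespace RightModule

variable (R : Type*) [NonUnitalRing R] {M : Type*} [AddCommGroup M] [RightModule R M]

/-- The subset `S` generates `M` as a right `R`-module: the only submodule that contains `S`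
is `M` itself. -/
def Generates (S : Set M) : Prop :=
  ∀ N : AddSubgroup M, (∀ m ∈ N, ∀ r : R, act m r ∈ N) → S ⊆ N → N = ⊤

variable (M) in
/-- `M` is unital: `M R = M`, i.e. every element is a finite sum of products `m r`. -/
def IsUnital : Prop :=
  AddSubgroup.closure {x : M | ∃ (m : M) (r : R), x = act m r} = ⊤

end RightModule

open RightModule

/-! ### Rings graded by the groupoid `X × X` and their graded modules

In the groupoid `X × X` the arrow `(a, b)` has range `a` and domain `b`. The product `(a, b)(c, d)`
is defined iff `b = c`, and then it is `(a, d)`. -/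

open scoped Classical in
/-- An object unital grading of the ring `R` by the groupoid `X × X`. The element `one e` is the
identity element of the ring `R_(e, e)`. -/
structure PairGrading (X : Type*) (R : Type*) [NonUnitalRing R] where
  comp : X × X → AddSubgroup R
  isInternal : DirectSum.IsInternal comp
  mul_mem : ∀ {a b d : X} {r s : R}, r ∈ comp (a, b) → s ∈ comp (b, d) → r * s ∈ comp (a, d)
  mul_eq_zero : ∀ {a b c d : X} {r s : R}, r ∈ comp (a, b) → s ∈ comp (c, d) → b ≠ c → r * s = 0
  one : X → R
  one_mem : ∀ e : X, one e ∈ comp (e, e)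
  one_mul : ∀ {a b : X} {r : R}, r ∈ comp (a, b) → one a * r = r
  mul_one : ∀ {a b : X} {r : R}, r ∈ comp (a, b) → r * one b = r

namespace PairGrading

variable {X R : Type*} [NonUnitalRing R] (𝓡 : PairGrading X R)

open scoped Classical in
/-- The family `𝓜` of subgroups makes the right `R`-module `M` an `X × X`-graded module. -/
structure IsGradedModule {M : Type*} [AddCommGroup M] [RightModule R M]
    (𝓜 : X × X → AddSubgroup M) : Prop where
  isInternal : DirectSum.IsInternal 𝓜
  act_mem : ∀ {a b d : X} {m : M} {r : R},
    m ∈ 𝓜 (a, b) → r ∈ 𝓡.comp (b, d) → act m r ∈ 𝓜 (a, d)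
  act_eq_zero : ∀ {a b c d : X} {m : M} {r : R},
    m ∈ 𝓜 (a, b) → r ∈ 𝓡.comp (c, d) → b ≠ c → act m r = 0

/-- The sequence `(x i)`, with `x i` homogeneous of degree `γ i`, is pseudo-linearly independent:
the only finitely supported `(a i)` with `a i ∈ 1_{d(γ i)} R` and `∑ x i a i = 0` is zero. -/
def PseudoLinearIndependent {M : Type*} [AddCommGroup M] [RightModule R M]
    {I : Type*} (γ : I → X × X) (x : I → M) : Prop :=
  ∀ a : I →₀ R, (∀ i, ∃ s : R, a i = 𝓡.one (γ i).2 * s) →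
    (a.sum fun i r => act (x i) r) = 0 → a = 0

/-- The graded module `(M, 𝓜)` is pseudo-free: it has a pseudo-basis, i.e. a pseudo-linearly
independent sequence of homogeneous elements which generates it. -/
def IsPseudoFree {M : Type u} [AddCommGroup M] [RightModule R M]
    (𝓜 : X × X → AddSubgroup M) : Prop :=
  ∃ (I : Type u) (γ : I → X × X) (x : I → M), (∀ i, x i ∈ 𝓜 (γ i)) ∧
    Generates R (Set.range x) ∧ 𝓡.PseudoLinearIndependent γ x

/-- `R` is a pfm ring: every (unital) graded right `R`-module is pseudo-free. -/
def IsPfm {X R : Type u} [NonUnitalRing R] (𝓡 : PairGrading X R) : Prop :=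
  ∀ (M : Type u) [AddCommGroup M] [RightModule R M] (𝓜 : X × X → AddSubgroup M),
    IsUnital R M → 𝓡.IsGradedModule 𝓜 → 𝓡.IsPseudoFree 𝓜

end PairGrading

/-! ### The ring of a small preadditive category -/

/-- The ring `R[C] = ⨁_{A, B} C(A, B)` of a small preadditive category. The component of degree
`(A, B)` is `C(B, A)`. -/
def CatRing (C : Type u) [SmallCategory C] [Preadditive C] : Type u :=
  DirectSum (C × C) fun p => (p.2 ⟶ p.1)

namespace CatRing

variable {C : Type u} [SmallCategory C] [Preadditive C]

instance : AddCommGroup (CatRing C) :=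
  inferInstanceAs (AddCommGroup (DirectSum (C × C) fun p => (p.2 ⟶ p.1)))

open scoped Classical in
/-- The inclusion of the component of degree `p` in `R[C]`. -/
def of (p : C × C) : (p.2 ⟶ p.1) →+ CatRing C :=
  DirectSum.of (fun p : C × C => (p.2 ⟶ p.1)) p

open scoped Classical in
/-- Additive maps out of `R[C]` are given on components. -/
def lift {G : Type*} [AddCommMonoid G] (φ : ∀ p : C × C, (p.2 ⟶ p.1) →+ G) : CatRing C →+ G :=
  DirectSum.toAddMonoid φ

@[simp]
theorem lift_of {G : Type*} [AddCommMonoid G] (φ : ∀ p : C × C, (p.2 ⟶ p.1) →+ G)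
    (p : C × C) (f : p.2 ⟶ p.1) : lift φ (of p f) = φ p f := by
  classical exact DirectSum.toAddMonoid_of φ p f

theorem hom_ext {G : Type*} [AddCommMonoid G] {φ ψ : CatRing C →+ G}
    (h : ∀ p f, φ (of p f) = ψ (of p f)) : φ = ψ := by
  classical exact DirectSum.addHom_ext h

open scoped Classical in
/-- The product of homogeneous elements: `f ∘ g` if the composition is possible, else `0`. -/
def mulHomog (p q : C × C) : (p.2 ⟶ p.1) →+ (q.2 ⟶ q.1) →+ CatRing C :=
  if h : q.1 = p.2 then
    AddMonoidHom.mk' (fun f => AddMonoidHom.mk' (fun g => of (p.1, q.2) (g ≫ eqToHom h ≫ f))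
      (by intro a b; simp [← map_add]))
      (by intro a b; ext g; simp [← map_add])
  else 0

/-- The product of `R[C]`. -/
def mulHom : CatRing C →+ CatRing C →+ CatRing C :=
  lift fun p => (lift fun q => (mulHomog p q).flip).flip

instance : Mul (CatRing C) := ⟨fun a b => mulHom a b⟩

theorem mul_def (a b : CatRing C) : a * b = mulHom a b := rfl

theorem of_mul_of_eq {p q : C × C} (h : q.1 = p.2) (f : p.2 ⟶ p.1) (g : q.2 ⟶ q.1) :
    of p f * of q g = of (p.1, q.2) (g ≫ eqToHom h ≫ f) := by
  simp [mul_def, mulHom, mulHomog, h]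

theorem of_mul_of {A B D : C} (f : B ⟶ A) (g : D ⟶ B) :
    of (A, B) f * of (B, D) g = of (A, D) (g ≫ f) :=
  (of_mul_of_eq (p := (A, B)) (q := (B, D)) rfl f g).trans
    (congrArg (of (A, D)) (congrArg (g ≫ ·) (Category.id_comp f)))

theorem of_mul_of_ne {p q : C × C} (h : p.2 ≠ q.1) (f : p.2 ⟶ p.1) (g : q.2 ⟶ q.1) :
    of p f * of q g = 0 := by
  simp [mul_def, mulHom, mulHomog, h.symm]

theorem mul_assoc_of (p q r : C × C) (f : p.2 ⟶ p.1) (g : q.2 ⟶ q.1) (h : r.2 ⟶ r.1) :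
    of p f * of q g * of r h = of p f * (of q g * of r h) := by
  obtain ⟨a, b⟩ := p
  obtain ⟨c, d⟩ := q
  obtain ⟨e, k⟩ := r
  have z1 : ∀ x : CatRing C, 0 * x = 0 := fun x => by simp [mul_def]
  have z2 : ∀ x : CatRing C, x * 0 = 0 := fun x => by simp [mul_def]
  by_cases h1 : b = c
  · subst h1
    by_cases h2 : d = e
    · subst h2
      have e1 : of (a, b) f * of (b, d) g = of (a, d) (g ≫ f) := of_mul_of f g
      have e2 : of (b, d) g * of (d, k) h = of (b, k) (h ≫ g) := of_mul_of g h
      have e3 : of (a, d) (g ≫ f) * of (d, k) h = of (a, k) (h ≫ g ≫ f) := of_mul_of (g ≫ f) h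
      have e4 : of (a, b) f * of (b, k) (h ≫ g) = of (a, k) ((h ≫ g) ≫ f) := of_mul_of f (h ≫ g)
      rw [e1, e2, e3, e4, Category.assoc]
    · have e1 : of (a, b) f * of (b, d) g = of (a, d) (g ≫ f) := of_mul_of f g
      rw [e1, of_mul_of_ne (p := (a, d)) h2, of_mul_of_ne (p := (b, d)) h2, z2]
  · rw [of_mul_of_ne (p := (a, b)) (q := (c, d)) h1, z1]
    by_cases h2 : d = e
    · subst h2
      have e1 : of (c, d) g * of (d, k) h = of (c, k) (h ≫ g) := of_mul_of g h
      rw [e1, of_mul_of_ne (p := (a, b)) (q := (c, k)) h1]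
    · rw [of_mul_of_ne (p := (c, d)) h2, z2]

instance : NonUnitalRing (CatRing C) where
  left_distrib a b c := by simp [mul_def]
  right_distrib a b c := by simp [mul_def]
  zero_mul a := by simp [mul_def]
  mul_zero a := by simp [mul_def]
  mul_assoc a b c := by
    have key : ∀ (p q : C × C) (f : p.2 ⟶ p.1) (g : q.2 ⟶ q.1),
        mulHom (mulHom (of p f) (of q g)) =
          (mulHom (of p f)).comp (mulHom (of q g)) := by
      intro p q f g
      exact hom_ext fun r h => mul_assoc_of p q r f g h
    have key2 : ∀ (p : C × C) (f : p.2 ⟶ p.1) (c : CatRing C),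
        (mulHom.flip c).comp (mulHom (of p f)) = (mulHom (of p f)).comp (mulHom.flip c) := by
      intro p f c
      exact hom_ext fun q g => DFunLike.congr_fun (key p q f g) c
    have key3 : (mulHom.flip c).comp (mulHom.flip b) = mulHom.flip (mulHom b c) :=
      hom_ext fun p f => DFunLike.congr_fun (key2 p f c) b
    exact DFunLike.congr_fun key3 a

variable (C) in
/-- The grading of `R[C]` by the groupoid `C₀ × C₀`, with `R[C]_(A, B) = C(B, A)` and with the
identity morphisms as local units. -/
def grading : PairGrading C (CatRing C) where
  comp p := (of p).range
  isInternal := by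
    classical
    let ψ : CatRing C →+ DirectSum (C × C) fun p => (of p : _ →+ CatRing C).range :=
      lift fun p => (DirectSum.of (fun p : C × C => (of p : _ →+ CatRing C).range) p).comp
        (of p).rangeRestrict
    have h1 : (DirectSum.coeAddMonoidHom fun p : C × C => (of p).range).comp ψ =
        AddMonoidHom.id _ := by
      refine hom_ext fun p f => ?_
      simp only [ψ, AddMonoidHom.comp_apply, lift_of]
      exact DirectSum.coeAddMonoidHom_of _ p _
    have h2 : ψ.comp (DirectSum.coeAddMonoidHom fun p : C × C => (of p).range) =
        AddMonoidHom.id _ := by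
      refine DirectSum.addHom_ext fun p y => ?_
      obtain ⟨_, f, rfl⟩ := y
      rw [AddMonoidHom.comp_apply, DirectSum.coeAddMonoidHom_of]
      exact lift_of _ p f
    exact ⟨Function.LeftInverse.injective (g := ψ) fun y => DFunLike.congr_fun h2 y,
      Function.RightInverse.surjective (g := ψ) fun y => DFunLike.congr_fun h1 y⟩
  mul_mem := by
    rintro a b d _ _ ⟨f, rfl⟩ ⟨g, rfl⟩
    exact ⟨g ≫ f, (of_mul_of f g).symm⟩
  mul_eq_zero := by
    rintro a b c d _ _ ⟨f, rfl⟩ ⟨g, rfl⟩ h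
    exact of_mul_of_ne h f g
  one e := of (e, e) (𝟙 e)
  one_mem e := ⟨𝟙 e, rfl⟩
  one_mul := by
    rintro a b _ ⟨f, rfl⟩
    exact (of_mul_of (𝟙 a) f).trans (by rw [Category.comp_id])
  mul_one := by
    rintro a b _ ⟨f, rfl⟩
    exact (of_mul_of f (𝟙 b)).trans (by rw [Category.id_comp])

end CatRing

/-! ### Free functors -/

/-- `(x i)`, with `x i ∈ F (A i)`, is a basis of the functor `F : D → Ab`: every `y ∈ F X` can be
written in a unique way as `∑ F(l i)(x i)` with `(l i) ∈ ⨁ i, D(A i, X)`. A contravariant functor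
on `C` is a functor on `D = Cᵒᵖ`, and then `l i` is a morphism `X ⟶ A i` of `C`. -/
def IsFunctorBasis {D : Type*} [Category D] [Preadditive D] (F : D ⥤ AddCommGrpCat)
    {I : Type*} (A : I → D) (x : ∀ i, F.obj (A i)) : Prop :=
  ∀ (X : D) (y : F.obj X), ∃! l : Π₀ i, (A i ⟶ X), y = ∑ᶠ i, F.map (l i) (x i)

/-- The functor `F` is free: it has a basis. -/
def IsFreeFunctor {D : Type u} [Category.{u} D] [Preadditive D] (F : D ⥤ AddCommGrpCat.{u}) :
    Prop :=
  ∃ (I : Type u) (A : I → D) (x : ∀ i, F.obj (A i)), IsFunctorBasis F A x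

/-! ### The category of finitely generated unital right modules -/

/-- A finitely generated unital right `R`-module. Its underlying set is a subset of a type, so that,
as in set theory, a module has as many isomorphic copies as one wants (even a zero module). -/
structure FGMod (R : Type u) [NonUnitalRing R] where
  {ambient : Type u}
  carrier : Set ambient
  [addCommGroup : AddCommGroup carrier]
  [rightModule : RightModule R carrier]
  unital : IsUnital R carrier
  fg : ∃ S : Finset carrier, Generates R (S : Set carrier)

namespace FGMod

attribute [instance] FGMod.addCommGroup FGMod.rightModule

variable {R : Type u} [NonUnitalRing R]

/-- The group of `R`-linear maps from `M` to `N`. -/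
def homs (M N : FGMod R) : AddSubgroup (M.carrier →+ N.carrier) where
  carrier := {f | ∀ (m : M.carrier) (r : R), f (act m r) = act (f m) r}
  add_mem' hf hg m r := by simp [hf m r, hg m r]
  zero_mem' m r := by simp
  neg_mem' hf m r := by simp [hf m r]

instance : Category.{u} (FGMod R) where
  Hom M N := homs M N
  id M := ⟨AddMonoidHom.id _, fun _ _ => rfl⟩
  comp f g := ⟨g.1.comp f.1, fun m r => by simp [f.2 m r, g.2 (f.1 m) r]⟩

instance : Preadditive (FGMod R) where
  homGroup M N := inferInstanceAs (AddCommGroup (homs M N))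
  add_comp _ _ _ _ _ g := Subtype.ext (AddMonoidHom.ext fun _ => map_add g.1 _ _)
  comp_add _ _ _ _ _ _ := rfl

/-- A surjective homomorphism `f` from `R` to a unital ring `S` makes `S` a finitely generated
unital right `R`-module by `s r = s * f r`. -/
def ofSurjective {S : Type u} [Ring S] (f : R →ₙ+* S) (hf : Function.Surjective f) : FGMod R :=
  letI : AddCommGroup (Set.univ : Set S) := (Equiv.Set.univ S).addCommGroup
  letI : RightModule R (Set.univ : Set S) :=
    { act := AddMonoidHom.mk' (fun s => AddMonoidHom.mk' (fun r => ⟨s.1 * f r, trivial⟩)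
          (by intro a b; apply Subtype.ext; simp [mul_add]; rfl))
        (by intro a b; ext r; exact add_mul a.1 b.1 (f r))
      act_mul := by intro m r s; apply Subtype.ext; simp [mul_assoc] }
  { carrier := (Set.univ : Set S)
    unital := by
      obtain ⟨r, hr⟩ := hf 1
      refine eq_top_iff.2 fun s _ => AddSubgroup.subset_closure ⟨s, r, Subtype.ext ?_⟩
      change s.1 = s.1 * f r
      rw [hr, mul_one]
    fg := by
      refine ⟨{⟨1, trivial⟩}, fun N hN h1 => eq_top_iff.2 fun s _ => ?_⟩
      obtain ⟨r, hr⟩ := hf s.1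
      have h := hN ⟨1, trivial⟩ (h1 (by simp)) r
      have e : act (⟨1, trivial⟩ : (Set.univ : Set S)) r = s := by
        apply Subtype.ext
        change 1 * f r = s.1
        rw [hr, one_mul]
      rwa [e] at h }

/-- The right module `S` over itself, for a unital ring `S`. -/
def regular (S : Type u) [Ring S] : FGMod S :=
  ofSurjective (NonUnitalRingHom.id S) Function.surjective_id

end FGMod

/-! ### Direct sums of rings, products of categories -/

/-- The ring `⨁ j, D j`, which has no unity in general. -/
def directSumRing {J : Type u} (D : J → Type u) [∀ j, Ring (D j)] :
    NonUnitalSubring (∀ j, D j) where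
  carrier := {f | {j | f j ≠ 0}.Finite}
  zero_mem' := by simp
  add_mem' {f g} hf hg := (hf.union hg).subset fun j hj => by
    by_contra h
    simp only [Set.mem_union, Set.mem_ofPred_eq, not_or, not_not] at h
    exact hj (by simp [h.1, h.2])
  neg_mem' {f} hf := by simpa using hf
  mul_mem' {f g} hf _ := hf.subset fun j hj h => hj (by simp [h])

/-- The projection of `⨁ j, D j` onto `D j`. -/
def directSumRing.proj {J : Type u} (D : J → Type u) [∀ j, Ring (D j)] (j : J) :
    directSumRing D →ₙ+* D j where
  toFun f := f.1 j
  map_zero' := rfl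
  map_add' _ _ := rfl
  map_mul' _ _ := rfl

theorem directSumRing.proj_surjective {J : Type u} (D : J → Type u) [∀ j, Ring (D j)] (j : J) :
    Function.Surjective (directSumRing.proj D j) := by
  classical
  intro d
  have h : {i | (Pi.single j d : ∀ i, D i) i ≠ 0} ⊆ {j} := fun i hi => by
    by_contra h
    exact hi (Pi.single_eq_of_ne h d)
  exact ⟨⟨Pi.single j d, (Set.finite_singleton j).subset h⟩, Pi.single_eq_same j d⟩

/-- `D j` as a right module over `⨁ j, D j`. -/
def FGMod.summand {J : Type u} (D : J → Type u) [∀ j, Ring (D j)] (j : J) :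
    FGMod (directSumRing D) :=
  FGMod.ofSurjective (directSumRing.proj D j) (directSumRing.proj_surjective D j)

instance piPreadditive {J : Type*} (𝓒 : J → Type*) [∀ j, Category (𝓒 j)]
    [∀ j, Preadditive (𝓒 j)] : Preadditive (∀ j, 𝓒 j) where
  homGroup X Y := inferInstanceAs (AddCommGroup (∀ j, X j ⟶ Y j))
  add_comp _ _ _ _ _ _ := funext fun _ => Preadditive.add_comp _ _ _ _ _ _
  comp_add _ _ _ _ _ _ := funext fun _ => Preadditive.comp_add _ _ _ _ _ _

/-- The objects of `∏^f j, 𝓒 j`: families in which all but finitely many members are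
zero objects. -/
def finiteFamilies {J : Type*} (𝓒 : J → Type*) [∀ j, Category (𝓒 j)] :
    ObjectProperty (∀ j, 𝓒 j) :=
  fun X => {j | ¬ IsZero (X j)}.Finite

/-- The full subcategory `∏^f j, 𝓒 j` of the product category. -/
abbrev FiniteProd {J : Type*} (𝓒 : J → Type*) [∀ j, Category (𝓒 j)] :=
  (finiteFamilies 𝓒).FullSubcategory

/-- The object `X` of `∏^f j, mod-D j` is the copy of the module `D j`: it is `D j` in position
`j` and a zero module elsewhere. -/
def IsCopy {J : Type u} (D : J → Type u) [∀ j, Ring (D j)] (j : J)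
    (X : FiniteProd fun j => FGMod (D j)) : Prop :=
  X.obj j = FGMod.regular (D j) ∧ ∀ i, i ≠ j → IsZero (X.obj i)

/-- Two preadditive categories are isomorphic: there is an additive functor which is bijective on
objects and on morphisms. -/
def PreadditiveIso (C D : Type*) [Category C] [Preadditive C] [Category D] [Preadditive D] : Prop :=
  ∃ F : C ⥤ D, F.Additive ∧ F.Full ∧ F.Faithful ∧ Function.Bijective F.obj

/-! ### Matrix descriptions -/

/-- A matrix description of `C` in which every `D j` is the endomorphism ring of an object `A j`
with `n (j, A j) = 1`. -/
def HasMatrixDescription (C : Type u) [SmallCategory C] [Preadditive C] : Prop :=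
  ∃ (J : Type u) (A : J → C) (D : J → Type u) (_ : ∀ j, DivisionRing (D j)) (n : J → C → ℕ)
    (φ : ∀ X Y : C, (X ⟶ Y) ≃+ ∀ j, Matrix (Fin (n j Y)) (Fin (n j X)) (D j)),
    (∀ X, {j | n j X ≠ 0}.Finite) ∧
    (∀ j, n j (A j) = 1) ∧
    (∀ j, Nonempty (End (A j) ≃+* D j)) ∧
    ∀ (X Z Y : C) (g : X ⟶ Z) (f : Z ⟶ Y) (j : J), φ X Y (g ≫ f) j = φ Z Y f j * φ X Z g j

end

open RightModule

noncomputable section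

/-! ### Families of simple objects -/

section SimpleFamily

variable {D : Type*} [Category D] [Preadditive D]

/-! All six conditions are compared with one self-dual statement: the category contains a simple
family, that is, nonzero objects `A j` with no nonzero morphisms between different members, with
division rings as endomorphism rings, and such that every identity is a finite sum of morphisms
through members of the family. This is semisimplicity with finite multiplicities. It passes to the
opposite category, so the two functor conditions reduce to one.

Simple family implies free: `F (A j)` is a vector space over `End (A j)`, and the union over `j` of
bases of these spaces is a basis of `F` (`IsSimpleFamily.isFreeFunctor`).

Free implies simple family: suppose that `𝟙 A` is not a sum of morphisms through objects out of
which all nonzero morphisms split. By Zorn, a maximal proper subfunctor `K` of the functor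
represented by `A` contains all such sums. The quotient by `K` is free, and a basis element at a
nonzero object `B` lifts to `p : A ⟶ B` with `p ≫ f ∈ K` only for `f = 0`. Maximality of `K` makes
`B` split simple, so `p` itself lies in `K`, a contradiction (`id_mem_splitSimpleSums`).

Simple family and matrices: an expression of `𝟙 X` with the fewest summands for each `j` is
orthonormal, hence decomposes `X` as a finite direct sum of copies of the `A j`, and morphisms
become families of matrices. Conversely, matrix units recover the sums for the identities.

Modules: finitely generated unital modules over a direct sum of division rings are finite sums of
the modules `D j`, which form a simple family. Conversely, a matrix description is realised by
modules of the prescribed dimensions; these have to be pairwise different sets, because an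
isomorphism of categories is bijective on objects.

Graded modules: each row `b ↦ M_(a, b)` of a graded module is a contravariant functor, and a functor
`F` gives the graded module all of whose rows are `F`. Bases of the rows and pseudo-bases
correspond. -/

/-- The endomorphisms of `X` which are sums of morphisms factoring through members of the
family `A`. -/
def factorSums {J : Type*} (A : J → D) (X : D) : AddSubgroup (X ⟶ X) :=
  AddSubgroup.closure {h | ∃ (j : J) (p : X ⟶ A j) (i : A j ⟶ X), h = p ≫ i}

/-- The nonzero objects `A j` are pairwise non-isomorphic and simple, in the sense that all nonzero
morphisms between them are split, and they generate: every identity is a sum of morphisms which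
factor through some `A j`. -/
structure IsSimpleFamily {J : Type*} (A : J → D) : Prop where
  eq_of_ne_zero : ∀ {j k : J} (f : A j ⟶ A k), f ≠ 0 → j = k
  exists_right_inv : ∀ {j : J} (f : A j ⟶ A j), f ≠ 0 → ∃ g, f ≫ g = 𝟙 (A j)
  id_ne_zero : ∀ j, 𝟙 (A j) ≠ 0
  id_mem : ∀ X, 𝟙 X ∈ factorSums A X

namespace IsSimpleFamily

variable {J : Type*} {A : J → D} (hA : IsSimpleFamily A)

-- A right inverse of a nonzero morphism is again nonzero and so has its own right inverse, which
-- must be the original morphism.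
include hA in
theorem exists_inv {j : J} (f : A j ⟶ A j) (hf : f ≠ 0) :
    ∃ g, f ≫ g = 𝟙 (A j) ∧ g ≫ f = 𝟙 (A j) := by
  obtain ⟨g, hg⟩ := hA.exists_right_inv f hf
  have hg0 : g ≠ 0 := by
    rintro rfl
    exact hA.id_ne_zero j (by rw [← hg, comp_zero])
  obtain ⟨h, hh⟩ := hA.exists_right_inv g hg0
  have : h = f := by
    rw [← Category.id_comp h, ← hg, Category.assoc, hh, Category.comp_id]
  exact ⟨g, hg, this ▸ hh⟩

include hA in
/-- A morphism is zero if all its compositions into the family are zero. -/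
theorem eq_zero_of_comp {X Y : D} (f : X ⟶ Y) (h : ∀ j (p : Y ⟶ A j), f ≫ p = 0) : f = 0 := by
  have key : ∀ e ∈ factorSums A Y, f ≫ e = 0 := by
    intro e he
    induction he using AddSubgroup.closure_induction with
    | mem e he =>
      obtain ⟨j, p, i, rfl⟩ := he
      rw [← Category.assoc, h, zero_comp]
    | zero => exact comp_zero
    | add a b _ _ ha hb => rw [Preadditive.comp_add, ha, hb, add_zero]
    | neg a _ ha => rw [Preadditive.comp_neg, ha, neg_zero]
  rw [← Category.comp_id f]
  exact key _ (hA.id_mem Y)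

-- The definition is self-dual because nonzero endomorphisms are invertible on both sides. This is
-- what makes freeness of covariant and of contravariant functors equivalent.
include hA in
theorem op : IsSimpleFamily fun j => Opposite.op (A j) where
  eq_of_ne_zero f hf := (hA.eq_of_ne_zero f.unop fun h => hf (Quiver.Hom.unop_inj h)).symm
  exists_right_inv f hf := by
    obtain ⟨g, -, hg⟩ := hA.exists_inv f.unop fun h => hf (Quiver.Hom.unop_inj h)
    exact ⟨g.op, Quiver.Hom.unop_inj hg⟩
  id_ne_zero j h := hA.id_ne_zero j (congrArg Quiver.Hom.unop h)
  id_mem X := by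
    have key : ∀ e ∈ factorSums A X.unop,
        (e.op : X ⟶ X) ∈ factorSums (fun j => Opposite.op (A j)) X := by
      intro e he
      induction he using AddSubgroup.closure_induction with
      | mem e he =>
        obtain ⟨j, p, i, rfl⟩ := he
        exact AddSubgroup.subset_closure ⟨j, i.op, p.op, rfl⟩
      | zero => exact zero_mem _
      | add a b _ _ ha hb => exact add_mem ha hb
      | neg a _ ha => exact neg_mem ha
    exact key _ (hA.id_mem X.unop)

end IsSimpleFamily

theorem IsSimpleFamily.unop {J : Type*} {A : J → Dᵒᵖ} (hA : IsSimpleFamily A) :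
    IsSimpleFamily fun j => (A j).unop where
  eq_of_ne_zero f hf := (hA.eq_of_ne_zero f.op fun h => hf (Quiver.Hom.op_inj h)).symm
  exists_right_inv f hf := by
    obtain ⟨g, -, hg⟩ := hA.exists_inv f.op fun h => hf (Quiver.Hom.op_inj h)
    exact ⟨g.unop, Quiver.Hom.op_inj hg⟩
  id_ne_zero j h := hA.id_ne_zero j (congrArg Quiver.Hom.op h)
  id_mem X := by
    have key : ∀ e ∈ factorSums A (Opposite.op X),
        (e.unop : X ⟶ X) ∈ factorSums (fun j => (A j).unop) X := by
      intro e he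
      induction he using AddSubgroup.closure_induction with
      | mem e he =>
        obtain ⟨j, p, i, rfl⟩ := he
        exact AddSubgroup.subset_closure ⟨j, i.unop, p.unop, rfl⟩
      | zero => exact zero_mem _
      | add a b _ _ ha hb => exact add_mem ha hb
      | neg a _ ha => exact neg_mem ha
    exact key _ (hA.id_mem (Opposite.op X))

end SimpleFamily

/-! ### Free functors -/

section FreeFunctors

variable {D : Type u} [Category.{u} D] [Preadditive D]

theorem finsum_map_eq_sum (F : D ⥤ AddCommGrpCat.{u}) [F.Additive] {I : Type*} (A : I → D)
    (x : ∀ i, F.obj (A i)) {X : D} (l : Π₀ i, (A i ⟶ X)) (s : Finset I)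
    (hs : ∀ i, l i ≠ 0 → i ∈ s) :
    ∑ᶠ i, F.map (l i) (x i) = ∑ i ∈ s, F.map (l i) (x i) := by
  refine finsum_eq_sum_of_support_subset _ fun i hi => hs i fun h => hi ?_
  simp [h]

theorem dfinsupp_support_finite {I : Type*} {β : I → Type*} [∀ i, Zero (β i)] (l : Π₀ i, β i) :
    {i | l i ≠ 0}.Finite := by
  classical
  exact (l.support.finite_toSet).subset fun i hi => by simpa using hi

theorem finite_map_support (F : D ⥤ AddCommGrpCat.{u}) [F.Additive] {I : Type*} (A : I → D)
    (x : ∀ i, F.obj (A i)) {X : D} (l : Π₀ i, (A i ⟶ X)) :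
    (Function.support fun i => F.map (l i) (x i)).Finite :=
  (dfinsupp_support_finite l).subset fun i hi h => hi (by simp [h])

/-- Criterion for a basis: independence and generation. -/
theorem isFunctorBasis_of (F : D ⥤ AddCommGrpCat.{u}) [F.Additive] {I : Type*} (A : I → D)
    (x : ∀ i, F.obj (A i))
    (hind : ∀ (X : D) (l : Π₀ i, (A i ⟶ X)), ∑ᶠ i, F.map (l i) (x i) = 0 → l = 0)
    (hgen : ∀ (X : D) (y : F.obj X), ∃ l : Π₀ i, (A i ⟶ X), y = ∑ᶠ i, F.map (l i) (x i)) :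
    IsFunctorBasis F A x := by
  intro X y
  obtain ⟨l, hl⟩ := hgen X y
  refine ⟨l, hl, fun l' hl' => sub_eq_zero.1 (hind X _ ?_)⟩
  have h := finsum_sub_distrib (finite_map_support F A x l') (finite_map_support F A x l)
  rw [← hl, ← hl', sub_self] at h
  rw [← h]
  exact finsum_congr fun i => by simp [Functor.map_sub]

/-- The elements generated by a family, as a subgroup. -/
def functorSpan (F : D ⥤ AddCommGrpCat.{u}) [F.Additive] {I : Type*} (A : I → D)
    (x : ∀ i, F.obj (A i)) (X : D) : AddSubgroup (F.obj X) where
  carrier := {y | ∃ l : Π₀ i, (A i ⟶ X), y = ∑ᶠ i, F.map (l i) (x i)}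
  zero_mem' := ⟨0, by simp⟩
  add_mem' := by
    rintro _ _ ⟨l, rfl⟩ ⟨l', rfl⟩
    refine ⟨l + l', ?_⟩
    rw [← finsum_add_distrib (finite_map_support F A x l) (finite_map_support F A x l')]
    exact finsum_congr fun i => by simp [Functor.map_add]
  neg_mem' := by
    rintro _ ⟨l, rfl⟩
    refine ⟨-l, ?_⟩
    rw [← finsum_neg_distrib]
    exact finsum_congr fun i => by simp [Functor.map_neg]

theorem map_mem_functorSpan (F : D ⥤ AddCommGrpCat.{u}) [F.Additive] {I : Type*} (A : I → D)
    (x : ∀ i, F.obj (A i)) {X : D} (i : I) (f : A i ⟶ X) :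
    F.map f (x i) ∈ functorSpan F A x X := by
  classical
  refine ⟨DFinsupp.single i f, ?_⟩
  rw [finsum_eq_single _ i]
  · simp
  · intro k hk
    rw [DFinsupp.single_eq_of_ne hk]
    simp

theorem map_functorSpan (F : D ⥤ AddCommGrpCat.{u}) [F.Additive] {I : Type*} (A : I → D)
    (x : ∀ i, F.obj (A i)) {X Y : D} (g : X ⟶ Y) {y : F.obj X} (hy : y ∈ functorSpan F A x X) :
    F.map g y ∈ functorSpan F A x Y := by
  classical
  obtain ⟨l, rfl⟩ := hy
  rw [finsum_map_eq_sum F A x l l.support (by simp), map_sum]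
  refine sum_mem fun i _ => ?_
  rw [← ConcreteCategory.comp_apply, ← F.map_comp]
  exact map_mem_functorSpan F A x i _

/-- The value of an additive functor at `X` is a left module over the endomorphism ring. -/
@[reducible]
def endModule (F : D ⥤ AddCommGrpCat.{u}) [F.Additive] (X : D) : Module (End X) (F.obj X) where
  smul f x := F.map f x
  one_smul x := by
    change F.map (𝟙 X) x = x
    simp
  mul_smul f g x := by
    change F.map (g ≫ f) x = F.map f (F.map g x)
    simp
  smul_zero f := map_zero (F.map f).hom
  smul_add f x y := map_add (F.map f).hom x y
  add_smul f g x := by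
    exact congrArg (fun h : F.obj X ⟶ F.obj X => h x) (F.map_add (f := (f : X ⟶ X)) (g := g))
  zero_smul x := by
    change F.map (0 : X ⟶ X) x = 0
    simp

/-- The endomorphism ring of a member of a simple family is a division ring. -/
@[reducible]
def IsSimpleFamily.divisionRing {D : Type*} [Category D] [Preadditive D] {J : Type*} {A : J → D}
    (hA : IsSimpleFamily A) (j : J) : DivisionRing (End (A j)) :=
  letI : Nontrivial (End (A j)) := ⟨𝟙 (A j), 0, hA.id_ne_zero j⟩
  DivisionRing.ofIsUnitOrEqZero fun f => by
    by_cases hf : f = 0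
    · exact Or.inr hf
    · obtain ⟨g, h1, h2⟩ := hA.exists_inv f hf
      exact Or.inl ⟨⟨f, g, h2, h1⟩, rfl⟩

/-- The basis is the disjoint union of bases of the vector spaces `F (A j)`. It generates because `y
= F (𝟙 X) y` and `𝟙 X` factors through the family; it is independent because coefficients are
detected by composing them into the family. -/
theorem IsSimpleFamily.isFreeFunctor {J : Type u} {A : J → D} (hA : IsSimpleFamily A)
    (F : D ⥤ AddCommGrpCat.{u}) [F.Additive] : IsFreeFunctor F := by
  classical
  let _ : ∀ j, DivisionRing (End (A j)) := fun j => hA.divisionRing j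
  let _ : ∀ j, Module (End (A j)) (F.obj (A j)) := fun j => endModule F (A j)
  let T : J → Type u := fun j => Module.Basis.ofVectorSpaceIndex (End (A j)) (F.obj (A j))
  let b : ∀ j, Module.Basis (T j) (End (A j)) (F.obj (A j)) := fun j =>
    Module.Basis.ofVectorSpace _ _
  let B : (Σ j, T j) → D := fun t => A t.1
  let x : ∀ t : Σ j, T j, F.obj (B t) := fun t => b t.1 t.2
  refine ⟨Σ j, T j, B, x, isFunctorBasis_of F B x ?_ ?_⟩
  · intro X l hl
    ext ⟨j, t⟩
    refine hA.eq_zero_of_comp (l ⟨j, t⟩) fun k p => ?_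
    by_contra hne
    obtain rfl := hA.eq_of_ne_zero _ hne
    rw [finsum_map_eq_sum F B x l l.support (by simp)] at hl
    -- Applying `F p` moves the relation into `F (A j)`. Terms belonging to another index vanish,
    -- and a linear relation over `End (A j)` between basis vectors remains.
    have h1 := congrArg (F.map p) hl
    rw [map_sum, map_zero] at h1
    simp only [← ConcreteCategory.comp_apply, ← F.map_comp] at h1
    have h2 : ∑ i ∈ l.support.preimage (Sigma.mk j) (sigma_mk_injective.injOn),
        (show End (A j) from l ⟨j, i⟩ ≫ p) • b j i = 0 := by
      rw [← h1]
      refine Finset.sum_preimage (Sigma.mk j) l.support sigma_mk_injective.injOn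
        (fun t => F.map (l t ≫ p) (x t)) ?_
      rintro ⟨k, i⟩ _ hi
      have : l ⟨k, i⟩ ≫ p = 0 := by
        by_contra hne
        obtain rfl := hA.eq_of_ne_zero _ hne
        exact hi ⟨i, rfl⟩
      simp [this]
    refine hne (linearIndependent_iff'.1 (b j).linearIndependent _ _ h2 t ?_)
    rw [Finset.mem_preimage, DFinsupp.mem_support_iff]
    intro h
    exact hne (by rw [h, zero_comp])
  · intro X y
    have h1 : ∀ (j : J) (z : F.obj (A j)), z ∈ functorSpan F B x (A j) := by
      intro j z
      rw [← (b j).linearCombination_repr z, Finsupp.linearCombination_apply]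
      refine sum_mem fun t _ => ?_
      exact map_mem_functorSpan F B x ⟨j, t⟩ _
    have key : ∀ e ∈ factorSums A X, F.map e y ∈ functorSpan F B x X := by
      intro e he
      induction he using AddSubgroup.closure_induction with
      | mem e he =>
        obtain ⟨j, p, i, rfl⟩ := he
        rw [F.map_comp, ConcreteCategory.comp_apply]
        exact map_functorSpan F B x i (h1 _ _)
      | zero => simp
      | add a b _ _ ha hb => simpa [Functor.map_add] using add_mem ha hb
      | neg a _ ha => simpa [Functor.map_neg] using neg_mem ha
    have := key _ (hA.id_mem X)
    rwa [F.map_id, ConcreteCategory.id_apply] at this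

end FreeFunctors

/-! ### Categories all of whose functors are free -/

section AllFree

variable {D : Type u} [Category.{u} D] [Preadditive D]

/-- A nonzero object such that all nonzero morphisms out of it are split. -/
def IsSplitSimple (B : D) : Prop :=
  𝟙 B ≠ 0 ∧ ∀ (X : D) (f : B ⟶ X), f ≠ 0 → ∃ g, f ≫ g = 𝟙 B

/-- The morphisms which are sums of morphisms factoring through split simple objects. -/
def splitSimpleSums (A X : D) : AddSubgroup (A ⟶ X) :=
  AddSubgroup.closure {h | ∃ (B : D) (p : A ⟶ B) (i : B ⟶ X), IsSplitSimple B ∧ h = p ≫ i}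

/-- The family of subgroups `K` is a subfunctor of the functor represented by `A`. -/
def IsSubfunctor {A : D} (K : ∀ X, AddSubgroup (A ⟶ X)) : Prop :=
  ∀ {X Y : D} (f : A ⟶ X) (g : X ⟶ Y), f ∈ K X → f ≫ g ∈ K Y

theorem isSubfunctor_splitSimpleSums (A : D) : IsSubfunctor (splitSimpleSums A) := by
  intro X Y f g hf
  refine AddSubgroup.closure_le ((splitSimpleSums A Y).comap (Preadditive.rightComp A g)) |>.2 ?_ hf
  rintro _ ⟨B, p, i, hB, rfl⟩
  exact AddSubgroup.subset_closure ⟨B, p, i ≫ g, hB, by simp [Preadditive.rightComp]⟩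

/-- The quotient of a representable functor by a subfunctor. -/
def quotFunctor {A : D} (K : ∀ X, AddSubgroup (A ⟶ X)) (hK : IsSubfunctor K) :
    D ⥤ AddCommGrpCat.{u} where
  obj X := AddCommGrpCat.of ((A ⟶ X) ⧸ K X)
  map {X Y} f := AddCommGrpCat.ofHom
    (QuotientAddGroup.map (K X) (K Y) (Preadditive.rightComp A f) fun g hg => hK g f hg)
  map_id X := by
    ext g
    change ((g ≫ 𝟙 X : A ⟶ X) : (A ⟶ X) ⧸ K X) = (g : (A ⟶ X) ⧸ K X)
    rw [Category.comp_id]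
  map_comp {X Y Z} f f' := by
    ext g
    change ((g ≫ f ≫ f' : A ⟶ Z) : (A ⟶ Z) ⧸ K Z) = (((g ≫ f) ≫ f' : A ⟶ Z) : (A ⟶ Z) ⧸ K Z)
    rw [Category.assoc]

theorem quotFunctor_map_mk {A : D} (K : ∀ X, AddSubgroup (A ⟶ X)) (hK : IsSubfunctor K) {X Y : D}
    (f : X ⟶ Y) (g : A ⟶ X) :
    (quotFunctor K hK).map f (QuotientAddGroup.mk g : (A ⟶ X) ⧸ K X) =
      (QuotientAddGroup.mk (g ≫ f) : (A ⟶ Y) ⧸ K Y) := rfl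

instance {A : D} (K : ∀ X, AddSubgroup (A ⟶ X)) (hK : IsSubfunctor K) :
    (quotFunctor K hK).Additive where
  map_add {X Y f f'} := by
    ext g
    obtain ⟨g, rfl⟩ := QuotientAddGroup.mk_surjective (s := K X) g
    change ((g ≫ (f + f') : A ⟶ Y) : (A ⟶ Y) ⧸ K Y) = ((g ≫ f + g ≫ f' : A ⟶ Y) : (A ⟶ Y) ⧸ K Y)
    rw [Preadditive.comp_add]

/-- A proper subfunctor of a representable functor is contained in a maximal one. -/
theorem exists_maximal_subfunctor {A : D} (N : ∀ X, AddSubgroup (A ⟶ X)) (hN : IsSubfunctor N)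
    (h1 : 𝟙 A ∉ N A) :
    ∃ K : ∀ X, AddSubgroup (A ⟶ X), N ≤ K ∧
      Maximal (fun K => IsSubfunctor K ∧ 𝟙 A ∉ K A) K := by
  refine zorn_le_nonempty₀ {K | IsSubfunctor K ∧ 𝟙 A ∉ K A} ?_ N ⟨hN, h1⟩
  intro c hc hchain K₀ hK₀
  have hmem : ∀ (X : D) (f : A ⟶ X), f ∈ sSup ((fun K : ∀ X, AddSubgroup (A ⟶ X) => K X) '' c) ↔
      ∃ K ∈ c, f ∈ K X := by
    intro X f
    rw [AddSubgroup.mem_sSup_of_directedOn (Set.Nonempty.image _ ⟨K₀, hK₀⟩)]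
    · simp
    · rintro _ ⟨K, hK, rfl⟩ _ ⟨K', hK', rfl⟩
      rcases hchain.total hK hK' with h | h
      · exact ⟨_, ⟨K', hK', rfl⟩, h X, le_rfl⟩
      · exact ⟨_, ⟨K, hK, rfl⟩, le_rfl, h X⟩
  refine ⟨fun X => sSup ((fun K : ∀ X, AddSubgroup (A ⟶ X) => K X) '' c), ⟨?_, ?_⟩, ?_⟩
  · intro X Y f g hf
    obtain ⟨K, hK, hf⟩ := (hmem X f).1 hf
    exact (hmem Y _).2 ⟨K, hK, (hc hK).1 f g hf⟩
  · intro h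
    obtain ⟨K, hK, h⟩ := (hmem A _).1 h
    exact (hc hK).2 h
  · intro K hK X f hf
    exact (hmem X f).2 ⟨K, hK, hf⟩

theorem IsFunctorBasis.eq_zero {F : D ⥤ AddCommGrpCat.{u}} [F.Additive] {I : Type*} {A : I → D}
    {x : ∀ i, F.obj (A i)} (h : IsFunctorBasis F A x) {i : I} {X : D} (f : A i ⟶ X)
    (hf : F.map f (x i) = 0) : f = 0 := by
  classical
  obtain ⟨l, -, hl⟩ := h X 0
  have e1 := hl 0 (by simp)
  have e2 := hl (DFinsupp.single i f) (by
    beta_reduce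
    rw [finsum_eq_single _ i]
    · simpa using hf.symm
    · intro k hk
      rw [DFinsupp.single_eq_of_ne hk]
      simp)
  rw [← e1] at e2
  simpa using e2

/-- Otherwise a maximal proper subfunctor `K` contains all these sums. Freeness of the quotient by
`K` then produces a split simple object `B i` and a morphism `p : A ⟶ B i` outside `K`, although `p`
factors through `B i`. -/
theorem id_mem_splitSimpleSums
    (h : ∀ F : D ⥤ AddCommGrpCat.{u}, F.Additive → IsFreeFunctor F) (A : D) :
    𝟙 A ∈ splitSimpleSums A A := by
  classical
  by_contra h1
  obtain ⟨K, hNK, ⟨hK, hK1⟩, hmax⟩ :=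
    exists_maximal_subfunctor _ (isSubfunctor_splitSimpleSums A) h1
  obtain ⟨I, B, x, hx⟩ := h (quotFunctor K hK) inferInstance
  -- If all the `B i` were zero objects, all coefficients would vanish, and so would the class of `𝟙
  -- A`.
  obtain ⟨i, hi⟩ : ∃ i, 𝟙 (B i) ≠ 0 := by
    by_contra! hB
    obtain ⟨l, hl, -⟩ := hx A (QuotientAddGroup.mk (𝟙 A) : (A ⟶ A) ⧸ K A)
    refine hK1 ((QuotientAddGroup.eq_zero_iff (𝟙 A)).1 (hl.trans ?_))
    refine finsum_eq_zero_of_forall_eq_zero fun i => ?_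
    have : l i = 0 := by rw [← Category.id_comp (l i), hB, zero_comp]
    simp [this]
  obtain ⟨p, hp⟩ := QuotientAddGroup.mk_surjective (s := K (B i)) (x i)
  have hmap : ∀ {X : D} (f : B i ⟶ X), p ≫ f ∈ K X → f = 0 := by
    intro X f hf
    refine hx.eq_zero f ?_
    rw [← hp, quotFunctor_map_mk]
    exact (QuotientAddGroup.eq_zero_iff _).2 hf
  have hsimple : IsSplitSimple (B i) := by
    refine ⟨hi, fun X f hf => ?_⟩
    -- The subfunctor generated by `K` and `p ≫ f`. It is strictly larger than `K`, since `p ≫ f ∈ K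
    -- X` would force `f = 0`; so it contains `𝟙 A`.
    let K' : ∀ Y, AddSubgroup (A ⟶ Y) := fun Y => K Y ⊔ (Preadditive.leftComp Y (p ≫ f)).range
    have hK' : IsSubfunctor K' := by
      intro Y Z a g ha
      obtain ⟨k, hk, _, ⟨b, rfl⟩, rfl⟩ := AddSubgroup.mem_sup.1 ha
      refine AddSubgroup.mem_sup.2 ⟨k ≫ g, hK k g hk, _, ⟨b ≫ g, rfl⟩, ?_⟩
      simp [Preadditive.leftComp]
    have h2 : 𝟙 A ∈ K' A := by
      by_contra h2
      have h3 := hmax ⟨hK', h2⟩ (fun Y => le_sup_left) X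
      refine hf (hmap f (h3 ?_))
      exact AddSubgroup.mem_sup_right ⟨𝟙 X, by simp [Preadditive.leftComp]⟩
    obtain ⟨k, hk, _, ⟨b, rfl⟩, h3⟩ := AddSubgroup.mem_sup.1 h2
    -- From `𝟙 A = k + p ≫ f ≫ b`, composing with `p` gives `p ≫ (f ≫ b ≫ p - 𝟙) = -(k ≫ p) ∈ K`,
    -- and `hmap` cancels `p`.
    refine ⟨b ≫ p, sub_eq_zero.1 (hmap _ ?_)⟩
    have h4 : p ≫ (f ≫ b ≫ p - 𝟙 (B i)) = -(k ≫ p) := by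
      have h5 : k = 𝟙 A - p ≫ f ≫ b := by
        rw [← h3]
        simp [Preadditive.leftComp]
      rw [h5]
      simp
    rw [h4]
    exact neg_mem (hK k p hk)
  have hpK : p ∈ K (B i) :=
    hNK (B i) (AddSubgroup.subset_closure ⟨B i, p, 𝟙 _, hsimple, (Category.comp_id p).symm⟩)
  exact hi (hmap (𝟙 _) (by rwa [Category.comp_id]))

/-- The family consists of one representative for each isomorphism class of split simple objects. A
nonzero morphism between two of these is an isomorphism, by the argument of
`IsSimpleFamily.exists_inv`. -/
theorem exists_isSimpleFamily_of_free
    (h : ∀ F : D ⥤ AddCommGrpCat.{u}, F.Additive → IsFreeFunctor F) :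
    ∃ (J : Type u) (A : J → D), IsSimpleFamily A := by
  let S : Setoid {B : D // IsSplitSimple B} :=
    { r := fun B B' => Nonempty (B.1 ≅ B'.1)
      iseqv := ⟨fun B => ⟨Iso.refl _⟩, fun ⟨e⟩ => ⟨e.symm⟩, fun ⟨e⟩ ⟨e'⟩ => ⟨e.trans e'⟩⟩ }
  refine ⟨Quotient S, fun j => j.out.1, ?_, ?_, ?_, ?_⟩
  · intro j k f hf
    obtain ⟨g, hg⟩ := j.out.2.2 _ f hf
    have hg0 : g ≠ 0 := by
      rintro rfl
      exact j.out.2.1 (by rw [← hg, comp_zero])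
    obtain ⟨f', hf'⟩ := k.out.2.2 _ g hg0
    have hff : f' = f := by rw [← Category.id_comp f', ← hg, Category.assoc, hf', Category.comp_id]
    rw [← j.out_eq, ← k.out_eq]
    exact Quotient.sound ⟨⟨f, g, hg, hff ▸ hf'⟩⟩
  · intro j f hf
    exact j.out.2.2 _ f hf
  · intro j
    exact j.out.2.1
  · intro X
    refine AddSubgroup.closure_mono ?_ (id_mem_splitSimpleSums h X)
    rintro _ ⟨B, p, i, hB, rfl⟩
    obtain ⟨e⟩ : Nonempty ((Quotient.mk S ⟨B, hB⟩).out.1 ≅ B) := Quotient.mk_out (s := S) ⟨B, hB⟩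
    exact ⟨Quotient.mk S ⟨B, hB⟩, p ≫ e.inv, e.hom ≫ i, by simp⟩

/-- All additive functors on `D` are free iff `D` is generated by a family of simple objects. -/
theorem forall_isFreeFunctor_iff :
    (∀ F : D ⥤ AddCommGrpCat.{u}, F.Additive → IsFreeFunctor F) ↔
      ∃ (J : Type u) (A : J → D), IsSimpleFamily A :=
  ⟨exists_isSimpleFamily_of_free, fun ⟨_, _, hA⟩ F _ => hA.isFreeFunctor F⟩

end AllFree

/-! ### Matrix descriptions and simple families -/

section Orthonormal

variable {D : Type*} [Category D] [Preadditive D]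

theorem exists_sum_of_mem_closure {B X : D} {s : X ⟶ X}
    (hs : s ∈ AddSubgroup.closure {h | ∃ (p : X ⟶ B) (i : B ⟶ X), h = p ≫ i}) :
    ∃ (n : ℕ) (p : Fin n → (X ⟶ B)) (i : Fin n → (B ⟶ X)), s = ∑ a, p a ≫ i a := by
  induction hs using AddSubgroup.closure_induction with
  | mem e he =>
    obtain ⟨p, i, rfl⟩ := he
    exact ⟨1, fun _ => p, fun _ => i, by simp⟩
  | zero => exact ⟨0, Fin.elim0, Fin.elim0, by simp⟩
  | add a b _ _ ha hb =>
    obtain ⟨n, p, i, rfl⟩ := ha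
    obtain ⟨m, q, k, rfl⟩ := hb
    exact ⟨n + m, Fin.append p q, Fin.append i k, by simp [Fin.sum_univ_add]⟩
  | neg a _ ha =>
    obtain ⟨n, p, i, rfl⟩ := ha
    exact ⟨n, fun a => -p a, i, by simp⟩

/-- If an endomorphism which is a sum of morphisms through `B` acts as identity on the morphisms
from `B`, and `B` has a division ring of endomorphisms, then the sum can be made orthonormal. -/
theorem exists_orthonormal {B X : D}
    (hB : ∀ f : B ⟶ B, f ≠ 0 → ∃ g, f ≫ g = 𝟙 B ∧ g ≫ f = 𝟙 B) {s : X ⟶ X}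
    (hs : s ∈ AddSubgroup.closure {h | ∃ (p : X ⟶ B) (i : B ⟶ X), h = p ≫ i})
    (hs1 : ∀ i : B ⟶ X, i ≫ s = i) :
    ∃ (n : ℕ) (p : Fin n → (X ⟶ B)) (i : Fin n → (B ⟶ X)), s = ∑ a, p a ≫ i a ∧
      ∀ a b, i a ≫ p b = if a = b then 𝟙 B else 0 := by
  classical
  -- An expression with the least number `n` of summands is orthonormal: any failure allows one
  -- summand to be removed.
  have hex := exists_sum_of_mem_closure hs
  obtain ⟨p, i, h⟩ := Nat.find_spec hex
  have hmin := fun m => Nat.find_min hex (m := m)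
  generalize Nat.find hex = n at p i h hmin
  refine ⟨n, p, i, h, fun a b => ?_⟩
  by_contra hne
  -- These are the coefficients of the relation `∑ w l ≫ i l = 0`, which says that `i a ≫ s = i a`.
  -- As `w b` is invertible, `i b` is a combination of the other `i l` and can be eliminated from
  -- `s`.
  let w : Fin n → (B ⟶ B) := fun b => i a ≫ p b - if a = b then 𝟙 B else 0
  obtain ⟨v, -, hv⟩ := hB (w b) (sub_ne_zero.2 hne)
  have hw : ∑ l, w l ≫ i l = 0 := by
    have h1 := hs1 (i a)
    rw [h, Preadditive.comp_sum] at h1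
    simp [w, Preadditive.sub_comp, Finset.sum_sub_distrib, h1, ite_comp]
  cases n with
  | zero => exact a.elim0
  | succ m =>
    refine hmin m (Nat.lt_succ_self m) ⟨fun l => p (b.succAbove l) - p b ≫ v ≫ w (b.succAbove l),
      fun l => i (b.succAbove l), ?_⟩
    rw [Fin.sum_univ_succAbove _ b] at hw h
    have hb : i b = -∑ l, v ≫ w (b.succAbove l) ≫ i (b.succAbove l) := by
      have h2 := congrArg (v ≫ ·) hw
      simp only [Preadditive.comp_add, comp_zero, Preadditive.comp_sum] at h2
      rw [← Category.assoc, hv, Category.id_comp] at h2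
      exact eq_neg_of_add_eq_zero_left h2
    rw [h]
    nth_rewrite 1 [hb]
    simp [Preadditive.comp_sum, sub_eq_neg_add, Finset.sum_add_distrib]

namespace IsSimpleFamily

variable {J : Type*} {A : J → D} (hA : IsSimpleFamily A)

/-- Grouping the summands by index gives one endomorphism `s j` of `X` for each `j`; in a
decomposition of `X` it is the projection onto its isotypic part. -/
theorem exists_finsupp_of_mem {X : D} {e : X ⟶ X} (he : e ∈ factorSums A X) :
    ∃ s : J →₀ (X ⟶ X), e = s.sum (fun _ x => x) ∧
      ∀ j, s j ∈ AddSubgroup.closure {h | ∃ (p : X ⟶ A j) (i : A j ⟶ X), h = p ≫ i} := by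
  classical
  induction he using AddSubgroup.closure_induction with
  | mem e he =>
    obtain ⟨j, p, i, rfl⟩ := he
    refine ⟨Finsupp.single j (p ≫ i), by simp, fun k => ?_⟩
    by_cases h : k = j
    · subst h
      exact AddSubgroup.subset_closure ⟨p, i, by simp⟩
    · rw [Finsupp.single_eq_of_ne h]
      exact zero_mem _
  | zero => exact ⟨0, by simp, fun _ => zero_mem _⟩
  | add a b _ _ ha hb =>
    obtain ⟨s, rfl, hs⟩ := ha
    obtain ⟨t, rfl, ht⟩ := hb
    exact ⟨s + t, (Finsupp.sum_add_index' (fun _ => rfl) fun _ _ _ => rfl).symm,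
      fun j => add_mem (hs j) (ht j)⟩
  | neg a _ ha =>
    obtain ⟨s, rfl, hs⟩ := ha
    exact ⟨-s, by simp [Finsupp.sum], fun j => neg_mem (hs j)⟩

include hA in
/-- Every object is a direct sum of finitely many members of a simple family. -/
theorem exists_decomposition (X : D) :
    ∃ (n : J → ℕ) (p : ∀ j, Fin (n j) → (X ⟶ A j)) (i : ∀ j, Fin (n j) → (A j ⟶ X))
      (S : Finset J), (∀ j, n j ≠ 0 → j ∈ S) ∧ 𝟙 X = ∑ j ∈ S, ∑ a, p j a ≫ i j a ∧
      ∀ j a b, i j a ≫ p j b = if a = b then 𝟙 (A j) else 0 := by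
  obtain ⟨s, h1, hs⟩ := exists_finsupp_of_mem (hA.id_mem X)
  -- Since `s k` factors through copies of `A k`, it kills all morphisms from `A j`. Hence `s j`
  -- acts as the identity on these, as `exists_orthonormal` requires.
  have hcross : ∀ {j k} (_ : j ≠ k) (i : A j ⟶ X), i ≫ s k = 0 := by
    intro j k hjk i
    have := hs k
    generalize s k = t at this ⊢
    induction this using AddSubgroup.closure_induction with
    | mem e he =>
      obtain ⟨p, q, rfl⟩ := he
      have : i ≫ p = 0 := by_contra fun h => hjk (hA.eq_of_ne_zero _ h)
      rw [← Category.assoc, this, zero_comp]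
    | zero => exact comp_zero
    | add a b _ _ ha hb => rw [Preadditive.comp_add, ha, hb, add_zero]
    | neg a _ ha => rw [Preadditive.comp_neg, ha, neg_zero]
  have hs1 : ∀ j (i : A j ⟶ X), i ≫ s j = i := by
    intro j i
    nth_rewrite 2 [← Category.comp_id i]
    rw [h1, Finsupp.sum, Preadditive.comp_sum]
    refine (Finset.sum_eq_single j (fun k _ hk => hcross hk.symm i) fun hj => ?_).symm
    rw [Finsupp.notMem_support_iff.1 hj, comp_zero]
  choose n p i hn hpi using fun j =>
    exists_orthonormal (fun f hf => hA.exists_inv f hf) (hs j) (hs1 j)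
  refine ⟨n, p, i, s.support, fun j hj => ?_, ?_, hpi⟩
  · rw [Finsupp.mem_support_iff]
    intro h0
    have a : Fin (n j) := ⟨0, Nat.pos_of_ne_zero hj⟩
    have h2 := hs1 j (i j a)
    rw [h0, comp_zero] at h2
    have h3 := hpi j a a
    rw [← h2, zero_comp, if_pos rfl] at h3
    exact hA.id_ne_zero j h3.symm
  · rw [h1]
    exact Finset.sum_congr rfl fun j _ => hn j

end IsSimpleFamily

end Orthonormal

/-! ### From a simple family to matrices -/

section MatrixDescription

variable {C : Type u} [SmallCategory C] [Preadditive C]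

/-- In the orthonormal decompositions of `X` and `Y`, the entries of `f` are `i ≫ f ≫ p`; entries
between different indices vanish. The product of `End` is composition in the order opposite to `≫`,
so composition becomes the matrix product in the required order. -/
theorem IsSimpleFamily.hasMatrixDescription {J : Type u} {A : J → C} (hA : IsSimpleFamily A) :
    HasMatrixDescription C := by
  classical
  choose n p i S hS h1 hpi using hA.exists_decomposition
  have hcross : ∀ {X j k} (_ : j ≠ k) (a b), i X j a ≫ p X k b = 0 := fun {X j k} h a b =>
    by_contra fun h0 => h (hA.eq_of_ne_zero _ h0)
  let φ : ∀ X Y : C, (X ⟶ Y) →+ ∀ j, Matrix (Fin (n Y j)) (Fin (n X j)) (End (A j)) := fun X Y =>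
    AddMonoidHom.mk' (fun f j => Matrix.of fun b a => i X j a ≫ f ≫ p Y j b) (by
      intro f g
      ext j b a
      change i X j a ≫ (f + g) ≫ p Y j b = i X j a ≫ f ≫ p Y j b + i X j a ≫ g ≫ p Y j b
      rw [Preadditive.add_comp, Preadditive.comp_add])
  have hφ : ∀ {X Y : C} (f : X ⟶ Y) j b a, φ X Y f j b a = i X j a ≫ f ≫ p Y j b :=
    fun _ _ _ _ => rfl
  have hinj : ∀ X Y, Function.Injective (φ X Y) := by
    intro X Y
    rw [injective_iff_map_eq_zero]
    intro f hf
    rw [← Category.id_comp f, ← Category.comp_id f, h1 X, h1 Y]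
    simp only [Preadditive.sum_comp, Preadditive.comp_sum, Category.assoc]
    refine Finset.sum_eq_zero fun k _ => Finset.sum_eq_zero fun b _ => Finset.sum_eq_zero
      fun j _ => Finset.sum_eq_zero fun a _ => ?_
    have : i X j a ≫ f ≫ p Y k b = 0 := by
      by_cases hjk : j = k
      · subst hjk
        exact congrFun (congrFun (congrFun hf j) b) a
      · exact by_contra fun h0 => hjk (hA.eq_of_ne_zero _ h0)
    have h2 := congrArg (fun t => p X j a ≫ t ≫ i Y k b) this
    simpa using h2
  have hsurj : ∀ X Y, Function.Surjective (φ X Y) := by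
    intro X Y N
    refine ⟨∑ j ∈ S X, ∑ a, ∑ b, p X j a ≫ (show A j ⟶ A j from N j b a) ≫ i Y j b, ?_⟩
    funext j
    ext b a
    rw [hφ]
    simp only [Preadditive.sum_comp, Preadditive.comp_sum, Category.assoc]
    rw [Finset.sum_eq_single j, Finset.sum_eq_single a, Finset.sum_eq_single b]
    · rw [hpi, if_pos rfl, Category.comp_id, ← Category.assoc, hpi, if_pos rfl, Category.id_comp]
    · intro b' _ hb
      rw [hpi, if_neg hb, comp_zero, comp_zero, comp_zero]
    · simp
    · intro a' _ ha
      refine Finset.sum_eq_zero fun b' _ => ?_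
      rw [← Category.assoc, hpi, if_neg ha.symm, zero_comp]
    · simp
    · intro k _ hk
      refine Finset.sum_eq_zero fun a' _ => Finset.sum_eq_zero fun b' _ => ?_
      rw [← Category.assoc, hcross hk.symm, zero_comp]
    · intro hj
      exact absurd (hS X j fun h => (h ▸ a).elim0) hj
  refine ⟨J, A, fun j => End (A j), fun j => hA.divisionRing j, fun j X => n X j,
    fun X Y => AddEquiv.ofBijective (φ X Y) ⟨hinj X Y, hsurj X Y⟩, fun X => ?_, fun j => ?_,
    fun j => ⟨RingEquiv.refl _⟩, ?_⟩
  · exact (S X).finite_toSet.subset fun j hj => hS X j hj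
  · have hunit : ∀ (a), ∃ g, i (A j) j a ≫ g = 𝟙 (A j) ∧ g ≫ i (A j) j a = 𝟙 (A j) := by
      intro a
      refine hA.exists_inv _ fun h0 => hA.id_ne_zero j ?_
      have := hpi (A j) j a a
      rw [h0, zero_comp, if_pos rfl] at this
      exact this.symm
    -- With no copy of `A j` its identity would be zero. With two copies, the first inclusion is
    -- invertible and orthogonal to the second projection, which would then vanish.
    rcases Nat.lt_trichotomy (n (A j) j) 1 with h | h | h
    · refine absurd ?_ (hA.id_ne_zero j)
      rw [h1 (A j)]
      refine Finset.sum_eq_zero fun k _ => Finset.sum_eq_zero fun a _ => ?_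
      by_cases hk : j = k
      · subst hk
        exact absurd a.2 (by omega)
      · have : p (A j) k a = 0 := by_contra fun h0 => hk (hA.eq_of_ne_zero _ h0)
        rw [this, zero_comp]
    · exact h
    · obtain ⟨g, -, hg⟩ := hunit ⟨0, by omega⟩
      have h2 := hpi (A j) j ⟨0, by omega⟩ ⟨1, by omega⟩
      rw [if_neg (by simp)] at h2
      have h3 : p (A j) j ⟨1, by omega⟩ = 0 := by
        rw [← Category.id_comp (p (A j) j ⟨1, by omega⟩), ← hg, Category.assoc, h2, comp_zero]
      have h4 := hpi (A j) j ⟨1, by omega⟩ ⟨1, by omega⟩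
      rw [h3, comp_zero, if_pos rfl] at h4
      exact absurd h4.symm (hA.id_ne_zero j)
  · intro X Z Y g f j
    ext b a
    change i X j a ≫ (g ≫ f) ≫ p Y j b = ∑ c, (i X j a ≫ g ≫ p Z j c) ≫ (i Z j c ≫ f ≫ p Y j b)
    have h2 : i X j a ≫ (g ≫ f) ≫ p Y j b = i X j a ≫ g ≫ 𝟙 Z ≫ f ≫ p Y j b := by simp
    rw [h2, h1 Z]
    simp only [Preadditive.sum_comp, Preadditive.comp_sum, Category.assoc]
    refine Finset.sum_eq_single j (fun k _ hk => Finset.sum_eq_zero fun c _ => ?_) fun hj => ?_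
    · have : i Z k c ≫ f ≫ p Y j b = 0 := by_contra fun h0 => hk (hA.eq_of_ne_zero _ h0)
      rw [this]
      simp
    · refine Finset.sum_eq_zero fun c _ => ?_
      exact absurd (hS Z j fun h => (h ▸ c).elim0) hj

end MatrixDescription

/-! ### From matrices to a simple family -/

section OfMatrixDescription

variable {C : Type u} [SmallCategory C] [Preadditive C] {J : Type u} {A : J → C} {D : J → Type u}
  [∀ j, DivisionRing (D j)] {n : J → C → ℕ}
  {φ : ∀ X Y : C, (X ⟶ Y) ≃+ ∀ j, Matrix (Fin (n j Y)) (Fin (n j X)) (D j)}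

/-- Only multiplicativity is assumed of `φ`; the identity is then preserved because `φ` also hits
the identity matrices. -/
theorem matrixDescription_map_id
    (hφ : ∀ (X Z Y : C) (g : X ⟶ Z) (f : Z ⟶ Y) (j : J), φ X Y (g ≫ f) j = φ Z Y f j * φ X Z g j)
    (X : C) (j : J) : φ X X (𝟙 X) j = 1 := by
  obtain ⟨f, hf⟩ := (φ X X).surjective 1
  have h := hφ X X X f (𝟙 X) j
  rwa [Category.comp_id, hf, Pi.one_apply, mul_one, eq_comm] at h

/-- The idempotent of `End (A j)` that corresponds to the factor `j` is `0` or `1`, because `End (A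
j)` is a division ring. It is nonzero as `n j (A j) = 1`, so it is the identity, and every other
factor has `1 = 0`, that is, size zero. -/
theorem matrixDescription_eq_zero
    (hn : ∀ j, n j (A j) = 1) (hD : ∀ j, Nonempty (End (A j) ≃+* D j))
    (hφ : ∀ (X Z Y : C) (g : X ⟶ Z) (f : Z ⟶ Y) (j : J), φ X Y (g ≫ f) j = φ Z Y f j * φ X Z g j)
    {j k : J} (hjk : k ≠ j) : n k (A j) = 0 := by
  classical
  obtain ⟨ψ⟩ := hD j
  obtain ⟨e, he⟩ := (φ (A j) (A j)).surjective
    (Pi.single (M := fun j' => Matrix (Fin (n j' (A j))) (Fin (n j' (A j))) (D j')) j 1)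
  have hee : e ≫ e = e := by
    apply (φ (A j) (A j)).injective
    funext l
    rw [hφ, he]
    by_cases hl : l = j
    · subst hl
      simp
    · simp [Pi.single_eq_of_ne hl]
  have he1 : e = 𝟙 (A j) := by
    have h1 : ψ e * ψ e = ψ e := by
      rw [← map_mul]
      exact congrArg ψ hee
    rcases (IsIdempotentElem.iff_eq_zero_or_one.1 h1).symm with h | h
    · exact ψ.injective (h.trans (map_one ψ).symm)
    · exfalso
      have h0 : e = 0 := ψ.injective (h.trans (map_zero ψ).symm)
      rw [h0, map_zero] at he
      have h2 := congrFun he j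
      rw [Pi.single_eq_same] at h2
      have a : Fin (n j (A j)) := ⟨0, by rw [hn]; exact one_pos⟩
      have h3 := congrFun (congrFun h2 a) a
      rw [Matrix.one_apply_eq] at h3
      exact zero_ne_one h3
  by_contra h
  have a : Fin (n k (A j)) := ⟨0, Nat.pos_of_ne_zero h⟩
  have h2 := matrixDescription_map_id hφ (A j) k
  rw [← he1, he, Pi.single_eq_of_ne hjk] at h2
  have h3 := congrFun (congrFun h2 a) a
  rw [Matrix.one_apply_eq] at h3
  exact zero_ne_one h3

theorem isSimpleFamily_of_matrixDescription
    (hfin : ∀ X, {j | n j X ≠ 0}.Finite)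
    (hn : ∀ j, n j (A j) = 1) (hD : ∀ j, Nonempty (End (A j) ≃+* D j))
    (hφ : ∀ (X Z Y : C) (g : X ⟶ Z) (f : Z ⟶ Y) (j : J), φ X Y (g ≫ f) j = φ Z Y f j * φ X Z g j) :
    IsSimpleFamily A where
  eq_of_ne_zero {j k} f hf := by
    by_contra hjk
    refine hf ((φ _ _).injective ?_)
    funext l
    ext b a
    by_cases hl : l = j
    · subst hl
      have := matrixDescription_eq_zero hn hD hφ hjk
      exact (Fin.cast this b).elim0
    · have := matrixDescription_eq_zero hn hD hφ hl
      exact (Fin.cast this a).elim0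
  exists_right_inv {j} f hf := by
    obtain ⟨ψ⟩ := hD j
    refine ⟨ψ.symm (ψ f)⁻¹, ψ.injective ?_⟩
    change ψ (ψ.symm (ψ f)⁻¹ * (show End (A j) from f)) = ψ 1
    rw [map_mul, ψ.apply_symm_apply, map_one]
    exact inv_mul_cancel₀ fun h => hf (ψ.injective (h.trans (map_zero ψ).symm))
  id_ne_zero j h := by
    obtain ⟨ψ⟩ := hD j
    have h1 : ψ 1 = ψ 0 := congrArg ψ h
    rw [map_one, map_zero] at h1
    exact one_ne_zero h1
  id_mem X := by
    classical
    -- Since `n j (A j) = 1`, the unit rows and unit columns are morphisms to and from `A j`. Their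
    -- composite is the diagonal matrix unit at `a`, and these sum to the identity.
    have hp : ∀ j (a : Fin (n j X)), ∃ p : X ⟶ A j, φ _ _ p = Pi.single
        (M := fun j' => Matrix (Fin (n j' (A j))) (Fin (n j' X)) (D j')) j
        (Matrix.of fun _ b => if b = a then 1 else 0) := fun j a => (φ _ _).surjective _
    have hi : ∀ j (a : Fin (n j X)), ∃ i : A j ⟶ X, φ _ _ i = Pi.single
        (M := fun j' => Matrix (Fin (n j' X)) (Fin (n j' (A j))) (D j')) j
        (Matrix.of fun b _ => if b = a then 1 else 0) := fun j a => (φ _ _).surjective _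
    choose p hp using hp
    choose i hi using hi
    have h : 𝟙 X = ∑ j ∈ (hfin X).toFinset, ∑ a, p j a ≫ i j a := by
      apply (φ _ _).injective
      funext k
      rw [matrixDescription_map_id hφ, map_sum, Finset.sum_apply]
      simp only [map_sum, Finset.sum_apply, hφ, hp, hi]
      rw [Finset.sum_eq_single k]
      · ext b b'
        simp only [Pi.single_eq_same, Matrix.sum_apply, Matrix.mul_apply, Matrix.of_apply,
          Finset.sum_const, Finset.card_univ, Fintype.card_fin, hn, one_smul]
        simp [Matrix.one_apply]
      · intro j _ hj
        simp [Pi.single_eq_of_ne hj.symm]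
      · intro hk
        have hk : n k X = 0 := by simpa using hk
        ext b
        exact (Fin.cast hk b).elim0
    rw [h]
    exact sum_mem fun j _ => sum_mem fun a _ => AddSubgroup.subset_closure ⟨j, _, _, rfl⟩

end OfMatrixDescription

theorem hasMatrixDescription_iff {C : Type u} [SmallCategory C] [Preadditive C] :
    HasMatrixDescription C ↔ ∃ (J : Type u) (A : J → C), IsSimpleFamily A := by
  constructor
  · rintro ⟨J, A, D, _, n, φ, hfin, hn, hD, hφ⟩
    exact ⟨J, A, isSimpleFamily_of_matrixDescription hfin hn hD hφ⟩
  · rintro ⟨J, A, hA⟩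
    exact hA.hasMatrixDescription

/-! ### Modules over direct sums of division rings -/

/-- The homomorphisms `q k` identify `R` with the direct sum of the rings `D k`. -/
structure IsRingSum {R : Type*} [NonUnitalRing R] {K : Type*} {D : K → Type*} [∀ k, Ring (D k)]
    (q : ∀ k, R →ₙ+* D k) : Prop where
  ext_zero : ∀ r, (∀ k, q k r = 0) → r = 0
  finite : ∀ r, {k | q k r ≠ 0}.Finite
  exists_single : ∀ k d, ∃ r, q k r = d ∧ ∀ l, l ≠ k → q l r = 0

namespace IsRingSum

section
variable {R : Type*} [NonUnitalRing R] {K : Type*} {D : K → Type*} [∀ k, Ring (D k)]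
    {q : ∀ k, R →ₙ+* D k} (hq : IsRingSum q)

include hq in
theorem ext {r s : R} (h : ∀ k, q k r = q k s) : r = s :=
  sub_eq_zero.1 (hq.ext_zero _ fun k => by rw [map_sub, h, sub_self])

include hq in
theorem surjective (k : K) : Function.Surjective (q k) := fun d =>
  let ⟨r, hr, _⟩ := hq.exists_single k d
  ⟨r, hr⟩

/-- The inclusion of the summand `D k`. -/
def single (k : K) (d : D k) : R := (hq.exists_single k d).choose

@[simp]
theorem map_single (k : K) (d : D k) : q k (hq.single k d) = d :=
  (hq.exists_single k d).choose_spec.1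

@[simp]
theorem map_single_of_ne {k l : K} (h : l ≠ k) (d : D k) : q l (hq.single k d) = 0 :=
  (hq.exists_single k d).choose_spec.2 l h

theorem single_add (k : K) (d d' : D k) :
    hq.single k (d + d') = hq.single k d + hq.single k d' := hq.ext fun l => by
  by_cases h : l = k
  · subst h; simp
  · simp [h]

theorem mul_single (k : K) (r : R) (d : D k) :
    r * hq.single k d = hq.single k (q k r * d) := hq.ext fun l => by
  by_cases h : l = k
  · subst h; simp
  · simp [h]

theorem single_mul (k : K) (r : R) (d : D k) :
    hq.single k d * r = hq.single k (d * q k r) := hq.ext fun l => by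
  by_cases h : l = k
  · subst h; simp
  · simp [h]

theorem mul_single_one_comm (k : K) (r : R) : r * hq.single k 1 = hq.single k 1 * r := by
  rw [mul_single, single_mul, one_mul, mul_one]

end

end IsRingSum

namespace FGMod

variable {R : Type u} [NonUnitalRing R]

theorem hom_ext {M N : FGMod R} {f g : M ⟶ N} (h : ∀ m, f.1 m = g.1 m) : f = g :=
  Subtype.ext (AddMonoidHom.ext h)

@[simp]
theorem comp_apply {M N P : FGMod R} (f : M ⟶ N) (g : N ⟶ P) (m : M.carrier) :
    (f ≫ g).1 m = g.1 (f.1 m) := rfl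

@[simp]
theorem id_apply {M : FGMod R} (m : M.carrier) : (𝟙 M : M ⟶ M).1 m = m := rfl

@[simp]
theorem zero_apply {M N : FGMod R} (m : M.carrier) : (0 : M ⟶ N).1 m = 0 := rfl

theorem sum_apply {M N : FGMod R} {ι : Type*} (s : Finset ι) (f : ι → (M ⟶ N)) (m : M.carrier) :
    (∑ a ∈ s, f a).1 m = ∑ a ∈ s, (f a).1 m := by
  let ev : (M ⟶ N) →+ N.carrier := AddMonoidHom.mk' (fun f => f.1 m) fun _ _ => rfl
  exact map_sum ev f s

variable {S : Type u} [Ring S]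

/-- The module `ofSurjective f hf` is `S`. -/
def ofSurjectiveEquiv (f : R →ₙ+* S) (hf : Function.Surjective f) :
    (ofSurjective f hf).carrier ≃+ S where
  toFun x := x.1
  invFun s := ⟨s, trivial⟩
  map_add' _ _ := rfl

end FGMod

namespace IsRingSum

variable {R : Type u} [NonUnitalRing R] {K : Type u} {D : K → Type u} [∀ k, DivisionRing (D k)]
    {q : ∀ k, R →ₙ+* D k} (hq : IsRingSum q)

theorem act_act_single_one (M : FGMod R) (k : K) (m : M.carrier) (d : D k) :
    act (act m (hq.single k d)) (hq.single k 1) = act m (hq.single k d) := by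
  rw [← act_mul, mul_single, map_single, mul_one]

/-- A finitely generated unital module is the direct sum of finitely many homogeneous parts. -/
theorem exists_sum_act_single (M : FGMod R) :
    ∃ T : Finset K, ∀ m : M.carrier, ∑ k ∈ T, act m (hq.single k 1) = m := by
  classical
  -- The claim is made for all larger index sets, so that it survives the addition of two elements.
  have h1 : ∀ m : M.carrier, ∃ T : Finset K, ∀ T', T ⊆ T' →
      ∑ k ∈ T', act m (hq.single k 1) = m := by
    intro m
    have hm : m ∈ AddSubgroup.closure {x : M.carrier | ∃ (m : M.carrier) (r : R), x = act m r} := by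
      rw [show _ = _ from M.unital]
      trivial
    induction hm using AddSubgroup.closure_induction with
    | mem x hx =>
      obtain ⟨m, r, rfl⟩ := hx
      refine ⟨(hq.finite r).toFinset, fun T' hT => ?_⟩
      simp_rw [← act_mul, mul_single_one_comm]
      rw [← map_sum]
      congr 1
      refine hq.ext fun k => ?_
      rw [map_sum]
      simp_rw [map_mul]
      by_cases hk : q k r = 0
      · simp [hk]
      · rw [Finset.sum_eq_single_of_mem k (hT (by simpa using hk)) fun l _ hl => ?_]
        · simp
        · simp [hl.symm]
    | zero => exact ⟨∅, by simp⟩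
    | add a b _ _ ha hb =>
      obtain ⟨T, hT⟩ := ha
      obtain ⟨T', hT'⟩ := hb
      refine ⟨T ∪ T', fun U hU => ?_⟩
      simp only [map_add, AddMonoidHom.add_apply, Finset.sum_add_distrib]
      rw [hT U (Finset.union_subset_left hU), hT' U (Finset.union_subset_right hU)]
    | neg a _ ha =>
      obtain ⟨T, hT⟩ := ha
      refine ⟨T, fun U hU => ?_⟩
      simp only [map_neg, AddMonoidHom.neg_apply, Finset.sum_neg_distrib]
      rw [hT U hU]
  choose T hT using h1
  obtain ⟨S, hS⟩ := M.fg
  let U : Finset K := S.biUnion T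
  -- The elements fixed by `∑ k ∈ U, e k`, with `e k` the unit of `D k`. They form a submodule
  -- because each `e k` is central, and `U` is chosen so that they include the generators.
  let N : AddSubgroup M.carrier :=
    (∑ k ∈ U, (act (R := R) (M := M.carrier)).flip (hq.single k 1)).eqLocus (AddMonoidHom.id _)
  have hN : ∀ m, m ∈ N ↔ ∑ k ∈ U, act m (hq.single k 1) = m := by
    intro m
    change (∑ k ∈ U, (act (R := R) (M := M.carrier)).flip (hq.single k 1)) m = m ↔ _
    rw [AddMonoidHom.finsetSum_apply]
    rfl
  have htop : N = ⊤ := by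
    refine hS N (fun m hm r => ?_) fun m hm => ?_
    · rw [hN] at hm ⊢
      simp_rw [← act_mul, mul_single_one_comm, act_mul]
      conv_rhs => rw [← hm]
      rw [map_sum, AddMonoidHom.finsetSum_apply]
    · exact (hN m).2 (hT m U (Finset.subset_biUnion_of_mem T hm))
  exact ⟨U, fun m => (hN m).1 (htop ▸ trivial)⟩

/-- The homogeneous part of a module. -/
def part (M : FGMod R) (k : K) : AddSubgroup M.carrier :=
  ((act (R := R) (M := M.carrier)).flip (hq.single k 1)).range

theorem act_single_mem_part (M : FGMod R) (k : K) (m : M.carrier) (d : D k) :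
    act m (hq.single k d) ∈ hq.part M k :=
  ⟨act m (hq.single k d), hq.act_act_single_one M k m d⟩

theorem act_single_one_of_mem_part {M : FGMod R} {k : K} {m : M.carrier} (hm : m ∈ hq.part M k) :
    act m (hq.single k 1) = m := by
  obtain ⟨m, rfl⟩ := hm
  exact hq.act_act_single_one M k m 1

/-- The homogeneous part is a right vector space. -/
@[reducible]
def partModule (M : FGMod R) (k : K) : Module (D k)ᵐᵒᵖ (hq.part M k) where
  smul d v := ⟨act v.1 (hq.single k d.unop), hq.act_single_mem_part M k _ _⟩
  one_smul v := Subtype.ext (hq.act_single_one_of_mem_part v.2)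
  mul_smul d d' v := Subtype.ext (by
    change act v.1 (hq.single k (d * d').unop) =
      act (act v.1 (hq.single k d'.unop)) (hq.single k d.unop)
    rw [← act_mul, mul_single, map_single]
    rfl)
  smul_zero d := Subtype.ext (by
    change act (0 : M.carrier) (hq.single k d.unop) = 0
    simp)
  smul_add d v w := Subtype.ext (by
    change act (v.1 + w.1) (hq.single k d.unop) =
      act v.1 (hq.single k d.unop) + act w.1 (hq.single k d.unop)
    simp)
  add_smul d d' v := Subtype.ext (by
    change act v.1 (hq.single k (d.unop + d'.unop)) =
      act v.1 (hq.single k d.unop) + act v.1 (hq.single k d'.unop)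
    rw [single_add, map_add])
  zero_smul v := Subtype.ext (by
    change act v.1 (hq.single k (0 : D k)) = 0
    rw [show hq.single k (0 : D k) = 0 from hq.ext_zero _ fun l => by
      by_cases h : l = k
      · subst h; simp
      · simp [h]]
    simp)

/-- The projection `m ↦ m e k` is semilinear along `q k`, so the images of generators of `M` span
the part. -/
theorem part_finite (M : FGMod R) (k : K) :
    letI := hq.partModule M k
    Module.Finite (D k)ᵐᵒᵖ (hq.part M k) := by
  classical
  let _ := hq.partModule M k
  obtain ⟨S, hS⟩ := M.fg
  let π : M.carrier →+ hq.part M k :=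
    AddMonoidHom.rangeRestrict ((act (R := R) (M := M.carrier)).flip (hq.single k 1))
  let V : Submodule (D k)ᵐᵒᵖ (hq.part M k) := Submodule.span _ (S.image π : Finset _)
  have hN : V.toAddSubgroup.comap π = ⊤ := by
    refine hS _ (fun m hm r => ?_) fun m hm => ?_
    · have : π (act m r) = MulOpposite.op (q k r) • π m := Subtype.ext (by
        change act (act m r) (hq.single k 1) =
          act (act m (hq.single k 1)) (hq.single k (q k r))
        rw [← act_mul, ← act_mul, mul_single, mul_single]
        simp)
      change π (act m r) ∈ V
      rw [this]
      exact V.smul_mem _ hm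
    · exact Submodule.subset_span (by simpa using ⟨m, m.2, hm, rfl⟩)
  refine ⟨S.image π, ?_⟩
  rw [eq_top_iff]
  rintro ⟨_, m, rfl⟩ -
  have : m ∈ V.toAddSubgroup.comap π := hN ▸ trivial
  exact this

/-- The module `D k` over `R`. -/
def summand (k : K) : FGMod R := FGMod.ofSurjective (q k) (hq.surjective k)

/-- The underlying group of `summand k` is `D k`. -/
def summandEquiv (k : K) : (hq.summand k).carrier ≃+ D k :=
  FGMod.ofSurjectiveEquiv (q k) (hq.surjective k)

theorem summandEquiv_act (k : K) (m : (hq.summand k).carrier) (r : R) :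
    hq.summandEquiv k (act m r) = hq.summandEquiv k m * q k r := rfl

theorem summandEquiv_symm_act (k : K) (d : D k) (r : R) :
    act ((hq.summandEquiv k).symm d) r = (hq.summandEquiv k).symm (d * q k r) := rfl

/-- Endomorphisms of `D k` are left multiplications, and the unit of `D j` acts as zero on `D k` for
`k ≠ j`. The identity of `M` is a sum over bases of its finitely many nonzero parts of coordinate
maps followed by inclusions. -/
theorem isSimpleFamily : IsSimpleFamily hq.summand where
  eq_of_ne_zero {j k} f hf := by
    by_contra hjk
    refine hf (FGMod.hom_ext fun m => (hq.summandEquiv k).injective ?_)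
    have h1 : act m (hq.single j 1) = m := (hq.summandEquiv j).injective (by
      rw [summandEquiv_act, map_single, mul_one])
    rw [← h1, f.2, summandEquiv_act, hq.map_single_of_ne (Ne.symm hjk), mul_zero, FGMod.zero_apply,
      map_zero]
  exists_right_inv {k} f hf := by
    let e := hq.summandEquiv k
    let v := e (f.1 (e.symm 1))
    have hf1 : ∀ m, e (f.1 m) = v * e m := by
      intro m
      have h1 : m = act (e.symm 1) (hq.single k (e m)) := e.injective (by
        rw [hq.summandEquiv_symm_act k, AddEquiv.apply_symm_apply, one_mul, map_single])
      conv_lhs => rw [h1]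
      rw [f.2, hq.summandEquiv_act k, map_single]
    have hv : v ≠ 0 := by
      intro h0
      refine hf (FGMod.hom_ext fun m => e.injective ?_)
      rw [hf1, h0, zero_mul, FGMod.zero_apply, map_zero]
    refine ⟨⟨(e.symm.toAddMonoidHom.comp (AddMonoidHom.mulLeft v⁻¹)).comp e.toAddMonoidHom, ?_⟩,
      FGMod.hom_ext fun m => e.injective ?_⟩
    · intro m r
      apply e.injective
      change e (e.symm (v⁻¹ * e (act m r))) = e (act (e.symm (v⁻¹ * e m)) r)
      rw [hq.summandEquiv_act k, hq.summandEquiv_act k, e.apply_symm_apply, e.apply_symm_apply,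
        mul_assoc]
    · change e (e.symm (v⁻¹ * e (f.1 m))) = e m
      rw [e.apply_symm_apply, hf1, inv_mul_cancel_left₀ hv]
  id_ne_zero k h := by
    have h1 : (𝟙 (hq.summand k) : hq.summand k ⟶ hq.summand k).1 ((hq.summandEquiv k).symm 1) = 0 :=
      by rw [h]; rfl
    rw [FGMod.id_apply] at h1
    exact one_ne_zero (((hq.summandEquiv k).symm.map_eq_zero_iff).1 h1)
  id_mem M := by
    classical
    obtain ⟨T, hT⟩ := hq.exists_sum_act_single M
    let _ : ∀ k, Module (D k)ᵐᵒᵖ (hq.part M k) := fun k => hq.partModule M k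
    have _ : ∀ k, Module.Finite (D k)ᵐᵒᵖ (hq.part M k) := fun k => hq.part_finite M k
    let b := fun k => Module.finBasis (D k)ᵐᵒᵖ (hq.part M k)
    let π : ∀ k, M.carrier →+ hq.part M k := fun k =>
      AddMonoidHom.rangeRestrict ((act (R := R) (M := M.carrier)).flip (hq.single k 1))
    have hπ : ∀ k m r, π k (act m r) = MulOpposite.op (q k r) • π k m := fun k m r =>
      Subtype.ext (by
        change act (act m r) (hq.single k 1) =
          act (act m (hq.single k 1)) (hq.single k (q k r))
        rw [← act_mul, ← act_mul, mul_single, mul_single]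
        simp)
    let p : ∀ k a, M ⟶ hq.summand k := fun k a =>
      ⟨AddMonoidHom.mk' (fun m => (hq.summandEquiv k).symm ((b k).repr (π k m) a).unop)
        (by intro m m'; simp), by
        intro m r
        apply (hq.summandEquiv k).injective
        rw [hq.summandEquiv_act k]
        simp [hπ]⟩
    let i : ∀ k a, hq.summand k ⟶ M := fun k a =>
      ⟨AddMonoidHom.mk' (fun d => act (b k a).1 (hq.single k (hq.summandEquiv k d)))
        (by intro m m'; simp [single_add]), by
        intro m r
        simp only [AddMonoidHom.mk'_apply]
        rw [← act_mul, single_mul, hq.summandEquiv_act k]⟩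
    have h : 𝟙 M = ∑ k ∈ T, ∑ a, p k a ≫ i k a := by
      refine FGMod.hom_ext fun m => ?_
      simp only [FGMod.sum_apply]
      rw [FGMod.id_apply]
      conv_lhs => rw [← hT m]
      refine Finset.sum_congr rfl fun k _ => ?_
      have h1 := congrArg Subtype.val ((b k).sum_repr (π k m))
      rw [AddSubgroup.val_finsetSum] at h1
      refine Eq.trans h1.symm (Finset.sum_congr rfl fun a _ => ?_)
      change act (b k a).1 (hq.single k ((b k).repr (π k m) a).unop) =
        act (b k a).1 (hq.single k (hq.summandEquiv k ((hq.summandEquiv k).symm _)))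
      rw [AddEquiv.apply_symm_apply]
    rw [h]
    exact sum_mem fun k _ => sum_mem fun a _ => AddSubgroup.subset_closure ⟨k, _, _, rfl⟩

end IsRingSum

/-! ### From categories of modules to simple families -/

section Transfer

/-- The last hypothesis concerns only objects `F.obj X`. In an infinite product of categories the
family need not generate all objects, only those with finitely many nonzero components. -/
theorem IsSimpleFamily.of_fullyFaithful {C E : Type*} [Category C] [Preadditive C] [Category E]
    [Preadditive E] (F : C ⥤ E) [F.Additive] [F.Full] [F.Faithful] {J : Type*} {A : J → C}
    (h1 : ∀ {j k : J} (f : F.obj (A j) ⟶ F.obj (A k)), f ≠ 0 → j = k)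
    (h2 : ∀ {j : J} (f : F.obj (A j) ⟶ F.obj (A j)), f ≠ 0 → ∃ g, f ≫ g = 𝟙 (F.obj (A j)))
    (h3 : ∀ j, 𝟙 (F.obj (A j)) ≠ 0)
    (h4 : ∀ X, 𝟙 (F.obj X) ∈ factorSums (fun j => F.obj (A j)) (F.obj X)) :
    IsSimpleFamily A where
  eq_of_ne_zero f hf := h1 (F.map f) ((F.map_eq_zero_iff).not.2 hf)
  exists_right_inv f hf := by
    obtain ⟨g, hg⟩ := h2 (F.map f) ((F.map_eq_zero_iff).not.2 hf)
    exact ⟨F.preimage g, F.map_injective (by simp [hg])⟩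
  id_ne_zero j h := h3 j (by rw [← F.map_id, h, F.map_zero])
  id_mem X := by
    have key : ∀ e ∈ factorSums (fun j => F.obj (A j)) (F.obj X),
        F.preimage e ∈ factorSums A X := by
      intro e he
      induction he using AddSubgroup.closure_induction with
      | mem e he =>
        obtain ⟨j, p, i, rfl⟩ := he
        exact AddSubgroup.subset_closure ⟨j, F.preimage p, F.preimage i, by simp⟩
      | zero =>
        rw [show F.preimage (0 : F.obj X ⟶ F.obj X) = 0 from F.map_injective (by simp)]
        exact zero_mem _
      | add a b _ _ ha hb =>
        rw [show F.preimage (a + b) = F.preimage a + F.preimage b from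
          F.map_injective (by simp [F.map_add])]
        exact add_mem ha hb
      | neg a _ ha =>
        rw [show F.preimage (-a) = -F.preimage a from F.map_injective (by simp [F.map_neg])]
        exact neg_mem ha
    have := key _ (h4 X)
    rwa [F.preimage_id] at this

theorem isRingSum_directSumRing {J : Type u} (D : J → Type u) [∀ j, Ring (D j)] :
    IsRingSum (directSumRing.proj D) where
  ext_zero r h := Subtype.ext (funext h)
  finite r := r.2
  exists_single k d := by
    classical
    refine ⟨⟨Pi.single k d, (Set.finite_singleton k).subset fun i hi => ?_⟩, Pi.single_eq_same k d,
      fun l hl => Pi.single_eq_of_ne hl d⟩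
    by_contra h
    exact hi (Pi.single_eq_of_ne h d)

/-- The case of a single summand, so that modules over one division ring are covered by the same
results as modules over `⨁ j, D j`. -/
theorem isRingSum_id (S : Type u) [Ring S] :
    IsRingSum (fun _ : PUnit.{u + 1} => NonUnitalRingHom.id S) where
  ext_zero _ h := h PUnit.unit
  finite _ := Set.toFinite _
  exists_single _ d := ⟨d, rfl, fun _ hl => (hl rfl).elim⟩

theorem exists_isSimpleFamily_of_directSumRing {C : Type u} [SmallCategory C] [Preadditive C]
    {J : Type u} {D : J → Type u} [∀ j, DivisionRing (D j)]
    {P : ObjectProperty (FGMod (directSumRing D))} (hP : ∀ j, P (FGMod.summand D j))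
    (h : PreadditiveIso C P.FullSubcategory) : ∃ (J : Type u) (A : J → C), IsSimpleFamily A := by
  obtain ⟨G, _, _, _, hG⟩ := h
  choose A hA using fun j => hG.2 ⟨FGMod.summand D j, hP j⟩
  have hobj : (fun j => (G ⋙ P.ι).obj (A j)) = (isRingSum_directSumRing D).summand := by
    funext j
    exact congrArg (·.obj) (hA j)
  have hS : IsSimpleFamily (fun j => (G ⋙ P.ι).obj (A j)) :=
    hobj ▸ (isRingSum_directSumRing D).isSimpleFamily
  exact ⟨J, A, IsSimpleFamily.of_fullyFaithful (G ⋙ P.ι) (fun f hf => hS.eq_of_ne_zero f hf)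
    (fun f hf => hS.exists_right_inv f hf) hS.id_ne_zero fun X => hS.id_mem _⟩

/-- A morphism into or out of a copy of `D j` is determined by its component `j`, so everything
reduces to the simple family `{D j}` of modules over `D j`. -/
theorem exists_isSimpleFamily_of_finiteProd {C : Type u} [SmallCategory C] [Preadditive C]
    {J : Type u} {D : J → Type u} [∀ j, DivisionRing (D j)]
    {P : ObjectProperty (FiniteProd fun j => FGMod (D j))}
    (hP : ∀ j, ∃ X, P X ∧ IsCopy D j X)
    (h : PreadditiveIso C P.FullSubcategory) : ∃ (J : Type u) (A : J → C), IsSimpleFamily A := by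
  classical
  obtain ⟨G, _, _, _, hG⟩ := h
  choose B hB using hP
  choose A hA using fun j => hG.2 ⟨B j, (hB j).1⟩
  let F : C ⥤ ∀ j, FGMod (D j) := (G ⋙ P.ι) ⋙ (finiteFamilies fun j => FGMod (D j)).ι
  have hF : F.Additive := ⟨fun {X Y f g} => by
    change ((G.map (f + g)).hom).hom = ((G.map f).hom).hom + ((G.map g).hom).hom
    rw [G.map_add]
    rfl⟩
  have hobj : ∀ j, F.obj (A j) = (B j).obj := fun j => congrArg (·.obj.obj) (hA j)
  have hreg : ∀ j, F.obj (A j) j = FGMod.regular (D j) := fun j => by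
    rw [hobj]
    exact (hB j).2.1
  have hzero : ∀ j i, i ≠ j → IsZero (F.obj (A j) i) := fun j i hi => by
    rw [hobj]
    exact (hB j).2.2 i hi
  have hsimple : ∀ j, IsSimpleFamily fun _ : PUnit.{u + 1} => FGMod.regular (D j) := fun j =>
    (isRingSum_id (D j)).isSimpleFamily
  have hsimple' : ∀ j, IsSimpleFamily fun _ : PUnit.{u + 1} => F.obj (A j) j := fun j => by
    rw [hreg]
    exact hsimple j
  refine ⟨J, A, IsSimpleFamily.of_fullyFaithful F ?_ ?_ ?_ ?_⟩
  · intro j k f hf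
    by_contra hjk
    refine hf (funext fun i => ?_)
    by_cases hi : i = j
    · exact (hzero k i fun h => hjk (hi.symm.trans h)).eq_of_tgt _ _
    · exact (hzero j i hi).eq_of_src _ _
  · intro j f hf
    have hfj : f j ≠ 0 := by
      intro h0
      refine hf (funext fun i => ?_)
      by_cases hi : i = j
      · subst hi
        exact h0
      · exact (hzero j i hi).eq_of_src _ _
    obtain ⟨g, hg⟩ := (hsimple' j).exists_right_inv (j := PUnit.unit) (f j) hfj
    refine ⟨Pi.single (M := fun i => (F.obj (A j) i ⟶ F.obj (A j) i)) j g, funext fun i => ?_⟩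
    by_cases hi : i = j
    · subst hi
      change f i ≫ Pi.single (M := fun k => (F.obj (A i) k ⟶ F.obj (A i) k)) i g i = 𝟙 _
      rw [Pi.single_eq_same]
      exact hg
    · exact (hzero j i hi).eq_of_src _ _
  · intro j h
    exact (hsimple' j).id_ne_zero PUnit.unit (congrFun h j)
  · intro X
    have hfin : {j | ¬ IsZero (F.obj X j)}.Finite := (G.obj X).obj.property
    -- Extension by zero from component `j`. As `X` has finitely many nonzero components, its
    -- identity is a finite sum of such extensions.
    let ι : ∀ j, (F.obj X j ⟶ F.obj X j) →+ (F.obj X ⟶ F.obj X) := fun j =>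
      AddMonoidHom.single (fun j => (F.obj X j ⟶ F.obj X j)) j
    have hid : 𝟙 (F.obj X) = ∑ j ∈ hfin.toFinset, ι j (𝟙 (F.obj X j)) := by
      funext i
      have h1 : (∑ j ∈ hfin.toFinset, ι j (𝟙 (F.obj X j))) i =
          ∑ j ∈ hfin.toFinset, (ι j (𝟙 (F.obj X j))) i :=
        Finset.sum_apply i hfin.toFinset
          (fun j => (ι j (𝟙 (F.obj X j)) : ∀ i, F.obj X i ⟶ F.obj X i))
      rw [h1, Finset.sum_eq_single i]
      · exact (Pi.single_eq_same (M := fun j => (F.obj X j ⟶ F.obj X j)) i (𝟙 (F.obj X i))).symm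
      · intro j _ hj
        exact Pi.single_eq_of_ne (M := fun j => (F.obj X j ⟶ F.obj X j)) hj.symm _
      · intro hi
        have : IsZero (F.obj X i) := by simpa using hi
        exact this.eq_of_src _ _
    rw [hid]
    refine sum_mem fun j _ => ?_
    have key : ∀ e ∈ factorSums (fun _ : PUnit.{u + 1} => F.obj (A j) j) (F.obj X j),
        ι j e ∈ factorSums (fun j => F.obj (A j)) (F.obj X) := by
      intro e he
      induction he using AddSubgroup.closure_induction with
      | mem e he =>
        obtain ⟨_, p, i, rfl⟩ := he
        refine AddSubgroup.subset_closure
          ⟨j, Pi.single (M := fun k => (F.obj X k ⟶ F.obj (A j) k)) j p,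
            Pi.single (M := fun k => (F.obj (A j) k ⟶ F.obj X k)) j i, funext fun k => ?_⟩
        change Pi.single (M := fun k => (F.obj X k ⟶ F.obj X k)) j (p ≫ i) k =
          Pi.single (M := fun k => (F.obj X k ⟶ F.obj (A j) k)) j p k ≫
            Pi.single (M := fun k => (F.obj (A j) k ⟶ F.obj X k)) j i k
        by_cases hk : k = j
        · subst hk
          rw [Pi.single_eq_same, Pi.single_eq_same, Pi.single_eq_same]
        · rw [Pi.single_eq_of_ne hk, Pi.single_eq_of_ne hk, zero_comp]
      | zero => simp
      | add a b _ _ ha hb => simpa using add_mem ha hb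
      | neg a _ ha => simpa using neg_mem ha
    exact key _ ((hsimple' j).id_mem _)

end Transfer

/-! ### Coordinates of modules over direct sums of division rings -/

section Coordinates

variable {R : Type u} [NonUnitalRing R] {K : Type u} {D : K → Type u} [∀ k, DivisionRing (D k)]

/-- An identification of `M` with `⨁ k, (D k) ^ (n k)`. -/
structure ModuleCoord (q : ∀ k, R →ₙ+* D k) (M : Type*) [AddCommGroup M] [RightModule R M]
    (n : K → ℕ) where
  equiv : M ≃+ ∀ k, Fin (n k) → D k
  equiv_act : ∀ m r k a, equiv (act m r) k a = equiv m k a * q k r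

namespace ModuleCoord

variable {q : ∀ k, R →ₙ+* D k} {M : Type*} [AddCommGroup M] [RightModule R M] {n : K → ℕ}

open scoped Classical in
/-- The standard basis. -/
def basis (c : ModuleCoord q M n) (k : K) (a : Fin (n k)) : M :=
  c.equiv.symm (Pi.single (M := fun k => Fin (n k) → D k) k (Pi.single a 1))

theorem equiv_basis_act (hq : IsRingSum q) (c : ModuleCoord q M n) (k : K) (a : Fin (n k))
    (d : D k) : c.equiv (act (c.basis k a) (hq.single k d)) =
      by classical exact Pi.single (M := fun k => Fin (n k) → D k) k (Pi.single a d) := by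
  classical
  funext l b
  rw [c.equiv_act, basis, AddEquiv.apply_symm_apply]
  by_cases hl : l = k
  · subst hl
    by_cases hb : b = a
    · subst hb
      simp
    · simp [hb]
  · simp [hl]

theorem eq_sum_basis (hq : IsRingSum q) (c : ModuleCoord q M n) (S : Finset K)
    (hS : ∀ k, n k ≠ 0 → k ∈ S) (m : M) :
    m = ∑ k ∈ S, ∑ a, act (c.basis k a) (hq.single k (c.equiv m k a)) := by
  classical
  apply c.equiv.injective
  simp only [map_sum, equiv_basis_act]
  funext k b
  have hk : k ∈ S := hS k fun h => (h ▸ b).elim0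
  rw [Finset.sum_apply, Finset.sum_apply, Finset.sum_eq_single_of_mem k hk]
  · simp only [Finset.sum_apply, Pi.single_eq_same]
    rw [Finset.sum_eq_single_of_mem b (Finset.mem_univ b)]
    · simp
    · intro a _ ha
      simp [ha.symm]
  · intro l _ hl
    simp [hl.symm]

theorem isUnital (hq : IsRingSum q) (c : ModuleCoord q M n) (hn : {k | n k ≠ 0}.Finite) :
    IsUnital R M := by
  refine eq_top_iff.2 fun m _ => ?_
  rw [c.eq_sum_basis hq hn.toFinset (by simp) m]
  exact sum_mem fun k _ => sum_mem fun a _ => AddSubgroup.subset_closure ⟨_, _, rfl⟩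

theorem exists_generates (hq : IsRingSum q) (c : ModuleCoord q M n) (hn : {k | n k ≠ 0}.Finite) :
    ∃ S : Finset M, Generates R (S : Set M) := by
  classical
  refine ⟨hn.toFinset.biUnion fun k => Finset.univ.image (c.basis k), fun N hN hS => ?_⟩
  refine eq_top_iff.2 fun m _ => ?_
  rw [c.eq_sum_basis hq hn.toFinset (by simp) m]
  refine sum_mem fun k hk => sum_mem fun a _ => hN _ (hS ?_) _
  simp only [Finset.coe_biUnion, Set.mem_iUnion]
  exact ⟨k, hk, by simp⟩

theorem subsingleton (c : ModuleCoord q M n) (hn : ∀ k, n k = 0) : Subsingleton M := by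
  refine ⟨fun m m' => c.equiv.injective ?_⟩
  funext k a
  exact (Fin.cast (hn k) a).elim0

/-- Homomorphisms given by matrices. -/
def hom {M M' : FGMod R} {n n' : K → ℕ} (c : ModuleCoord q M.carrier n)
    (c' : ModuleCoord q M'.carrier n') (N : ∀ k, Matrix (Fin (n' k)) (Fin (n k)) (D k)) :
    M ⟶ M' :=
  ⟨AddMonoidHom.mk' (fun m => c'.equiv.symm fun k => (N k).mulVec (c.equiv m k)) (by
      intro m m'
      rw [← map_add]
      congr 1
      funext k
      rw [map_add]
      exact Matrix.mulVec_add _ _ _), by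
    intro m r
    apply c'.equiv.injective
    funext k b
    simp only [AddMonoidHom.mk'_apply]
    rw [AddEquiv.apply_symm_apply, c'.equiv_act, AddEquiv.apply_symm_apply]
    simp only [Matrix.mulVec, dotProduct, c.equiv_act, Finset.sum_mul, mul_assoc]⟩

theorem equiv_hom {M M' : FGMod R} {n n' : K → ℕ} (c : ModuleCoord q M.carrier n)
    (c' : ModuleCoord q M'.carrier n') (N : ∀ k, Matrix (Fin (n' k)) (Fin (n k)) (D k))
    (m : M.carrier) (k : K) :
    c'.equiv ((c.hom c' N).1 m) k = (N k).mulVec (c.equiv m k) := by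
  change c'.equiv (c'.equiv.symm _) k = _
  rw [AddEquiv.apply_symm_apply]

theorem hom_one {M : FGMod R} {n : K → ℕ} (c : ModuleCoord q M.carrier n)
    {N : ∀ k, Matrix (Fin (n k)) (Fin (n k)) (D k)} (hN : ∀ k, N k = 1) : c.hom c N = 𝟙 M := by
  refine FGMod.hom_ext fun m => c.equiv.injective (funext fun k => ?_)
  rw [equiv_hom, hN, Matrix.one_mulVec]
  rfl

theorem hom_mul {M M' M'' : FGMod R} {n n' n'' : K → ℕ} (c : ModuleCoord q M.carrier n)
    (c' : ModuleCoord q M'.carrier n') (c'' : ModuleCoord q M''.carrier n'')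
    (N : ∀ k, Matrix (Fin (n' k)) (Fin (n k)) (D k))
    (N' : ∀ k, Matrix (Fin (n'' k)) (Fin (n' k)) (D k))
    {N'' : ∀ k, Matrix (Fin (n'' k)) (Fin (n k)) (D k)} (hN : ∀ k, N'' k = N' k * N k) :
    c.hom c'' N'' = c.hom c' N ≫ c'.hom c'' N' := by
  refine FGMod.hom_ext fun m => c''.equiv.injective (funext fun k => ?_)
  rw [equiv_hom, FGMod.comp_apply, equiv_hom, equiv_hom, Matrix.mulVec_mulVec, hN]

theorem hom_add {M M' : FGMod R} {n n' : K → ℕ} (c : ModuleCoord q M.carrier n)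
    (c' : ModuleCoord q M'.carrier n') (N N' : ∀ k, Matrix (Fin (n' k)) (Fin (n k)) (D k)) :
    c.hom c' (N + N') = c.hom c' N + c.hom c' N' := by
  refine FGMod.hom_ext fun m => c'.equiv.injective (funext fun k => ?_)
  change _ = c'.equiv ((c.hom c' N).1 m + (c.hom c' N').1 m) k
  rw [map_add, Pi.add_apply, equiv_hom, equiv_hom, equiv_hom, Pi.add_apply, Matrix.add_mulVec]

theorem hom_injective {M M' : FGMod R} {n n' : K → ℕ} (c : ModuleCoord q M.carrier n)
    (c' : ModuleCoord q M'.carrier n') : Function.Injective (c.hom c') := by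
  classical
  intro N N' h
  funext k
  ext b a
  have h1 : c'.equiv ((c.hom c' N).1 (c.basis k a)) k b =
    c'.equiv ((c.hom c' N').1 (c.basis k a)) k b := by rw [h]
  rw [equiv_hom, equiv_hom, basis, AddEquiv.apply_symm_apply, Pi.single_eq_same] at h1
  simpa using h1

/-- The columns of the matrix are the images of the standard basis; finiteness is needed to write
each element as a finite sum over that basis. -/
theorem hom_surjective (hq : IsRingSum q) {M M' : FGMod R} {n n' : K → ℕ}
    (c : ModuleCoord q M.carrier n) (c' : ModuleCoord q M'.carrier n')
    (hn : {k | n k ≠ 0}.Finite) : Function.Surjective (c.hom c') := by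
  classical
  intro f
  refine ⟨fun k => Matrix.of fun b a => c'.equiv (f.1 (c.basis k a)) k b,
    FGMod.hom_ext fun m => c'.equiv.injective (funext fun k => funext fun b => ?_)⟩
  rw [equiv_hom]
  conv_rhs => rw [c.eq_sum_basis hq hn.toFinset (by simp) m]
  have hf : ∀ m r, f.1 (act m r) = act (f.1 m) r := f.2
  simp only [map_sum, hf, Finset.sum_apply, c'.equiv_act]
  simp only [Matrix.mulVec, dotProduct, Matrix.of_apply]
  by_cases hk : n k = 0
  · have : IsEmpty (Fin (n k)) := hk ▸ Fin.isEmpty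
    rw [Fintype.sum_empty]
    refine (Finset.sum_eq_zero fun l _ => Finset.sum_eq_zero fun a _ => ?_).symm
    have hl : k ≠ l := by
      rintro rfl
      exact isEmptyElim a
    rw [hq.map_single_of_ne hl, mul_zero]
  · rw [Finset.sum_eq_single_of_mem k (by simpa using hk)]
    · simp
    · intro l _ hl
      refine Finset.sum_eq_zero fun a _ => ?_
      rw [hq.map_single_of_ne hl.symm, mul_zero]

end ModuleCoord

/-- The carrier of a module with given dimensions, tagged by an element of `T`. -/
def taggedSet {T : Type u} (n : K → T → ℕ) (D : K → Type u) (t : T) :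
    Set (Σ t, ∀ k, Fin (n k t) → D k) :=
  Set.range (Sigma.mk t)

/-- The tagged set is a copy of `⨁ k, (D k) ^ (n k t)`. -/
def taggedEquiv {T : Type u} (n : K → T → ℕ) (D : K → Type u) (t : T) :
    taggedSet n D t ≃ ∀ k, Fin (n k t) → D k :=
  (Equiv.ofInjective _ sigma_mk_injective).symm

/-- The group structure on a tagged set. -/
@[reducible]
def taggedGroup {T : Type u} (n : K → T → ℕ) (t : T) : AddCommGroup (taggedSet n D t) :=
  (taggedEquiv n D t).addCommGroup

/-- The module structure on a tagged set. -/
@[reducible]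
def taggedModule (q : ∀ k, R →ₙ+* D k) {T : Type u} (n : K → T → ℕ) (t : T) :
    letI := taggedGroup (D := D) n t
    RightModule R (taggedSet n D t) :=
  letI := taggedGroup (D := D) n t
  let e : taggedSet n D t ≃+ ∀ k, Fin (n k t) → D k := (taggedEquiv n D t).addEquiv
  { act := AddMonoidHom.mk' (fun m => AddMonoidHom.mk'
        (fun r => e.symm fun k a => e m k a * q k r) (by
          intro r s
          rw [← map_add]
          congr 1
          funext k a
          simp [mul_add])) (by
        intro m m'
        ext1 r
        change e.symm _ = e.symm _ + e.symm _
        rw [← map_add]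
        congr 1
        funext k a
        simp [add_mul])
    act_mul := by
      intro m r s
      change e.symm _ = e.symm _
      congr 1
      funext k a
      change _ = e (e.symm _) k a * _
      rw [e.apply_symm_apply, map_mul, mul_assoc] }

/-- The coordinates of a tagged module. -/
def taggedCoord (q : ∀ k, R →ₙ+* D k) {T : Type u} (n : K → T → ℕ) (t : T) :
    letI := taggedGroup (D := D) n t
    letI := taggedModule q n t
    ModuleCoord q (taggedSet n D t) (fun k => n k t) :=
  letI := taggedGroup (D := D) n t
  letI := taggedModule q n t
  { equiv := (taggedEquiv n D t).addEquiv
    equiv_act := by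
      intro m r k a
      change (taggedEquiv n D t).addEquiv ((taggedEquiv n D t).addEquiv.symm _) k a = _
      rw [AddEquiv.apply_symm_apply] }

/-- A module with given dimensions, tagged by an element of `T`. -/
def taggedMod {q : ∀ k, R →ₙ+* D k} (hq : IsRingSum q) {T : Type u} (n : K → T → ℕ)
    (hn : ∀ t, {k | n k t ≠ 0}.Finite) (t : T) : FGMod R :=
  letI := taggedGroup (D := D) n t
  letI := taggedModule q n t
  { carrier := taggedSet n D t
    unital := (taggedCoord q n t).isUnital hq (hn t)
    fg := (taggedCoord q n t).exists_generates hq (hn t) }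

theorem taggedMod_injective {q : ∀ k, R →ₙ+* D k} (hq : IsRingSum q) {T : Type u} (n : K → T → ℕ)
    (hn : ∀ t, {k | n k t ≠ 0}.Finite) : Function.Injective (taggedMod hq n hn) := by
  intro t t' h
  have h1 : HEq (taggedMod hq n hn t).carrier (taggedMod hq n hn t').carrier := by rw [h]
  have h2 : taggedSet n D t = taggedSet n D t' := eq_of_heq h1
  have h3 : (⟨t, 0⟩ : Σ t, ∀ k, Fin (n k t) → D k) ∈ taggedSet n D t' := h2 ▸ ⟨0, rfl⟩
  obtain ⟨_, h4⟩ := h3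
  exact (congrArg Sigma.fst h4).symm

/-- This separates tagged modules from the modules `summand k`, whose carriers are the whole ambient
type. -/
theorem taggedMod_carrier_ne_univ {q : ∀ k, R →ₙ+* D k} (hq : IsRingSum q) {T : Type u}
    (n : K → T → ℕ) (hn : ∀ t, {k | n k t ≠ 0}.Finite) {t t' : T} (h : t ≠ t') :
    (taggedMod hq n hn t).carrier ≠ Set.univ := by
  intro h1
  have h2 : (⟨t', 0⟩ : Σ t, ∀ k, Fin (n k t) → D k) ∈ taggedSet n D t :=
    (show taggedSet n D t = Set.univ from h1) ▸ trivial
  obtain ⟨_, h4⟩ := h2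
  exact h (congrArg Sigma.fst h4)

open scoped Classical in
/-- The coordinate of a summand. -/
def summandCoord {q : ∀ k, R →ₙ+* D k} (hq : IsRingSum q) {n : K → ℕ} (j : K) (h1 : n j = 1)
    (h0 : ∀ k, k ≠ j → n k = 0) : ModuleCoord q (hq.summand j).carrier n where
  equiv := (hq.summandEquiv j).trans
    { toFun := fun d => Pi.single (M := fun k => Fin (n k) → D k) j (fun _ => d)
      invFun := fun v => v j ⟨0, by omega⟩
      left_inv := fun d => by simp
      right_inv := fun v => by
        funext k a
        by_cases hk : k = j
        · subst hk
          beta_reduce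
          rw [Pi.single_eq_same]
          congr 1
          apply Fin.ext
          have := a.2
          simp only
          omega
        · exact (Fin.cast (h0 k hk) a).elim0
      map_add' := fun d d' => by rw [← Pi.single_add]; rfl }
  equiv_act m r k a := by
    by_cases hk : k = j
    · subst hk
      simp [hq.summandEquiv_act]
    · exact (Fin.cast (h0 k hk) a).elim0

end Coordinates

/-! ### From matrix descriptions to categories of modules -/

section Models

theorem IsRingSum.summand_injective {R : Type u} [NonUnitalRing R] {K : Type u} {D : K → Type u}
    [∀ k, DivisionRing (D k)] {q : ∀ k, R →ₙ+* D k} (hq : IsRingSum q) :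
    Function.Injective hq.summand := by
  intro j k h
  refine hq.isSimpleFamily.eq_of_ne_zero (eqToHom h) fun h0 => hq.isSimpleFamily.id_ne_zero j ?_
  rw [← eqToHom_refl _ rfl, ← eqToHom_trans h h.symm, h0, zero_comp]

theorem FGMod.isZero_of_subsingleton {R : Type u} [NonUnitalRing R] (M : FGMod R)
    [Subsingleton M.carrier] : IsZero M :=
  (IsZero.iff_id_eq_zero M).2 (FGMod.hom_ext fun _ => Subsingleton.elim _ _)

/-- The target is the full subcategory on the image; injectivity on objects turns an equivalence
with it into an isomorphism. -/
theorem preadditiveIso_of_injective {C E : Type*} [Category C] [Preadditive C] [Category E]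
    [Preadditive E] (F : C ⥤ E) [F.Additive] [F.Full] [F.Faithful]
    (hF : Function.Injective F.obj) :
    PreadditiveIso C (ObjectProperty.FullSubcategory fun Y : E => ∃ X, F.obj X = Y) := by
  let P : ObjectProperty E := fun Y => ∃ X, F.obj X = Y
  refine ⟨P.lift F fun X => ⟨X, rfl⟩, ⟨fun {X Y f g} => ?_⟩, inferInstance, inferInstance, ?_, ?_⟩
  · apply InducedCategory.hom_ext
    exact F.map_add
  · intro X Y h
    exact hF (congrArg (·.obj) h)
  · rintro ⟨_, X, rfl⟩
    exact ⟨X, rfl⟩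

variable {R : Type u} [NonUnitalRing R] {K : Type u} {D : K → Type u} [∀ k, DivisionRing (D k)]
  {q : ∀ k, R →ₙ+* D k} (hq : IsRingSum q) {C : Type u} (n : K → C → ℕ)
  (hn : ∀ X, {k | n k X ≠ 0}.Finite) (A : K → C)

open scoped Classical in
/-- The modules with dimensions `n k X`, chosen to be pairwise distinct, and with the given
summand at `A k`. -/
def modelObj (X : C) : FGMod R :=
  if h : ∃ k, A k = X then hq.summand h.choose else taggedMod hq n hn X

theorem modelObj_apply (hA : Function.Injective A) (k : K) :
    modelObj hq n hn A (A k) = hq.summand k := by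
  have h : ∃ l, A l = A k := ⟨k, rfl⟩
  rw [modelObj, dif_pos h, hA h.choose_spec]

theorem modelObj_of_ne {X : C} (h : ∀ k, A k ≠ X) :
    modelObj hq n hn A X = taggedMod hq n hn X := by
  rw [modelObj, dif_neg (by simpa using h)]

/-- Tags separate the tagged modules, carriers separate these from the summands, and the summands
are separated by having no nonzero morphisms between different ones. -/
theorem modelObj_injective (hA : Function.Injective A) :
    Function.Injective (modelObj hq n hn A) := by
  have key : ∀ (k : K) (Y : C), (∀ l, A l ≠ Y) →
      modelObj hq n hn A (A k) ≠ modelObj hq n hn A Y := by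
    intro k Y hY h
    rw [modelObj_apply hq n hn A hA, modelObj_of_ne hq n hn A hY] at h
    refine taggedMod_carrier_ne_univ hq n hn (hY k).symm ?_
    rw [← h]
    rfl
  intro X Y h
  by_cases hX : ∃ k, A k = X
  · obtain ⟨k, rfl⟩ := hX
    by_cases hY : ∃ l, A l = Y
    · obtain ⟨l, rfl⟩ := hY
      rw [modelObj_apply hq n hn A hA, modelObj_apply hq n hn A hA] at h
      rw [hq.summand_injective h]
    · exact absurd h (key k Y (by simpa using hY))
  · by_cases hY : ∃ l, A l = Y
    · obtain ⟨l, rfl⟩ := hY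
      exact absurd h.symm (key l X (by simpa using hX))
    · rw [modelObj_of_ne hq n hn A (by simpa using hX),
        modelObj_of_ne hq n hn A (by simpa using hY)] at h
      exact taggedMod_injective hq n hn h

variable {n A} in
theorem nonempty_modelCoord (hA : Function.Injective A) (h1 : ∀ k, n k (A k) = 1)
    (h0 : ∀ k l, l ≠ k → n l (A k) = 0) (X : C) :
    Nonempty (ModuleCoord q (modelObj hq n hn A X).carrier fun k => n k X) := by
  by_cases hX : ∃ k, A k = X
  · obtain ⟨k, rfl⟩ := hX
    rw [modelObj_apply hq n hn A hA]
    exact ⟨summandCoord hq k (h1 k) (h0 k)⟩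
  · rw [modelObj_of_ne hq n hn A (by simpa using hX)]
    exact ⟨taggedCoord q n X⟩

end Models

/-! ### Realising a matrix description by modules -/

section MatrixModels

variable {C : Type u} [SmallCategory C] [Preadditive C]

theorem HasMatrixDescription.exists_directSumRing (h : HasMatrixDescription C) :
    ∃ (J : Type u) (D : J → Type u) (_ : ∀ j, DivisionRing (D j))
      (P : ObjectProperty (FGMod (directSumRing D))),
      (∀ j, P (FGMod.summand D j)) ∧ PreadditiveIso C P.FullSubcategory := by
  obtain ⟨J, A, D, _, n, φ, hfin, hn, hD, hφ⟩ := h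
  have h0 : ∀ k l, l ≠ k → n l (A k) = 0 := fun k l =>
    matrixDescription_eq_zero hn hD hφ
  have hA : Function.Injective A := by
    intro j k hjk
    by_contra hne
    have := h0 k j hne
    rw [← hjk, hn] at this
    exact one_ne_zero this
  have hq := isRingSum_directSumRing D
  have c := fun X => (nonempty_modelCoord hq hfin hA hn h0 X).some
  let F : C ⥤ FGMod (directSumRing D) :=
    { obj := modelObj hq n hfin A
      map := fun {X Y} f => (c X).hom (c Y) (φ X Y f)
      map_id := fun X => (c X).hom_one (matrixDescription_map_id hφ X)
      map_comp := fun f g => (c _).hom_mul (c _) (c _) _ _ fun k => hφ _ _ _ _ _ k }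
  have hadd : F.Additive := ⟨fun {X Y f g} => by
    change (c X).hom (c Y) (φ X Y (f + g)) = _
    rw [map_add, ModuleCoord.hom_add]⟩
  have hfull : F.Full := ⟨fun {X Y} f => by
    obtain ⟨N, rfl⟩ := (c X).hom_surjective hq (c Y) (hfin X) f
    obtain ⟨g, rfl⟩ := (φ X Y).surjective N
    exact ⟨g, rfl⟩⟩
  have hfaithful : F.Faithful := ⟨fun {X Y f g} hfg =>
    (φ X Y).injective ((c X).hom_injective (c Y) hfg)⟩
  refine ⟨J, D, inferInstance, fun Y => ∃ X, F.obj X = Y, fun j => ⟨A j, ?_⟩,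
    preadditiveIso_of_injective F (modelObj_injective hq n hfin A hA)⟩
  exact modelObj_apply hq n hfin A hA j

/-- In component `j`, the object `X` goes to a model of dimension `n j X` over the single division
ring `D j`, with `A j` going to `D j` itself. -/
theorem HasMatrixDescription.exists_finiteProd (h : HasMatrixDescription C)
    (hC : (∀ A : C, IsZero A) → Subsingleton C) :
    ∃ (J : Type u) (D : J → Type u) (_ : ∀ j, DivisionRing (D j))
      (P : ObjectProperty (FiniteProd fun j => FGMod (D j))),
      (∀ j, ∃ X, P X ∧ IsCopy D j X) ∧ PreadditiveIso C P.FullSubcategory := by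
  obtain ⟨J, A, D, _, n, φ, hfin, hn, hD, hφ⟩ := h
  have h0 : ∀ k l, l ≠ k → n l (A k) = 0 := fun k l =>
    matrixDescription_eq_zero hn hD hφ
  let A' : J → PUnit.{u + 1} → C := fun j _ => A j
  let n' : J → PUnit.{u + 1} → C → ℕ := fun j _ => n j
  have hA' : ∀ j, Function.Injective (A' j) := fun j => Function.injective_of_subsingleton _
  have hq := fun j => isRingSum_id (D j)
  have hfin' : ∀ j X, {k | n' j k X ≠ 0}.Finite := fun j X => Set.toFinite _
  have c := fun j X => (nonempty_modelCoord (hq j) (hfin' j) (hA' j) (fun _ => hn j)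
    (fun _ _ hl => (hl rfl).elim) X).some
  let M : C → ∀ j, FGMod (D j) := fun X j => modelObj (hq j) (n' j) (hfin' j) (A' j) X
  have hzero : ∀ X j, n j X = 0 → IsZero (M X j) := fun X j hj => by
    have := (c j X).subsingleton fun _ => hj
    exact FGMod.isZero_of_subsingleton _
  let F₀ : C ⥤ ∀ j, FGMod (D j) :=
    { obj := M
      map := fun {X Y} f j => (c j X).hom (c j Y) fun _ => φ X Y f j
      map_id := fun X => funext fun j =>
        (c j X).hom_one fun _ => matrixDescription_map_id hφ X j
      map_comp := fun f g => funext fun j =>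
        (c j _).hom_mul (c j _) (c j _) _ _ fun _ => hφ _ _ _ _ _ j }
  let F : C ⥤ FiniteProd fun j => FGMod (D j) := (finiteFamilies fun j => FGMod (D j)).lift F₀
    fun X => (hfin X).subset fun j hj h => hj (hzero X j h)
  have hadd : F.Additive := ⟨fun {X Y f g} => by
    apply InducedCategory.hom_ext
    funext j
    change (c j X).hom (c j Y) (fun _ => φ X Y (f + g) j) =
      (c j X).hom (c j Y) (fun _ => φ X Y f j) + (c j X).hom (c j Y) (fun _ => φ X Y g j)
    rw [map_add, ← ModuleCoord.hom_add]
    rfl⟩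
  have hfull : F.Full := ⟨fun {X Y} f => by
    choose N hN using fun j => (c j X).hom_surjective (hq j) (c j Y) (hfin' j X) (f.hom j)
    obtain ⟨g, hg⟩ := (φ X Y).surjective fun j => N j PUnit.unit
    refine ⟨g, InducedCategory.hom_ext (funext fun j => ?_)⟩
    change (c j X).hom (c j Y) (fun _ => φ X Y g j) = f.hom j
    rw [← hN, hg]⟩
  have hfaithful : F.Faithful := ⟨fun {X Y f g} hfg => by
    refine (φ X Y).injective (funext fun j => ?_)
    exact congrFun ((c j X).hom_injective (c j Y) (congrFun (congrArg (·.hom) hfg) j)) PUnit.unit⟩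
  -- Any single component separates the objects. If `J` is empty, the product has only one object;
  -- then all objects of `C` are zero, and the hypothesis `hC` leaves at most one of them.
  have hinj : Function.Injective F.obj := by
    rcases isEmpty_or_nonempty J with hJ | ⟨⟨j⟩⟩
    · have : Subsingleton C := hC fun X => (IsZero.iff_id_eq_zero X).2
        ((φ X X).injective (Subsingleton.elim _ _))
      exact Function.injective_of_subsingleton _
    · intro X Y hXY
      exact modelObj_injective (hq j) (n' j) (hfin' j) (A' j) (hA' j)
        (congrFun (congrArg (·.obj) hXY) j)
  refine ⟨J, D, inferInstance, fun Y => ∃ X, F.obj X = Y, fun j => ⟨F.obj (A j), ⟨A j, rfl⟩, ?_, ?_⟩,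
    preadditiveIso_of_injective F hinj⟩
  · exact modelObj_apply (hq j) (n' j) (hfin' j) (A' j) (hA' j) PUnit.unit
  · exact fun i hi => hzero _ _ (h0 j i hi)

end MatrixModels

/-! ### Graded modules over the ring of a category -/

section GradedToFunctor

variable {C : Type u} [SmallCategory C] [Preadditive C]

theorem CatRing.induction {p : CatRing C → Prop} (r : CatRing C) (zero : p 0)
    (of : ∀ q f, p (CatRing.of q f)) (add : ∀ r s, p r → p s → p (r + s)) : p r := by
  classical
  exact DirectSum.induction_on (β := fun q : C × C => (q.2 ⟶ q.1)) r zero of add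

/-- The homogeneous component of an element of `R[C]`. -/
def CatRing.proj (p : C × C) : CatRing C →+ (p.2 ⟶ p.1) :=
  DFinsupp.evalAddMonoidHom p

theorem CatRing.proj_of (p : C × C) (f : p.2 ⟶ p.1) : CatRing.proj p (CatRing.of p f) = f := by
  classical
  exact DirectSum.of_eq_same _ _

theorem CatRing.proj_of_ne {p q : C × C} (h : p ≠ q) (f : q.2 ⟶ q.1) :
    CatRing.proj p (CatRing.of q f) = 0 := by
  classical
  exact DirectSum.of_eq_of_ne _ _ _ h

theorem CatRing.of_mul_one (p : C × C) (f : p.2 ⟶ p.1) :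
    CatRing.of p f * (CatRing.grading C).one p.2 = CatRing.of p f :=
  (CatRing.grading C).mul_one (a := p.1) (b := p.2) ⟨f, rfl⟩

theorem CatRing.one_mul_of (p : C × C) (f : p.2 ⟶ p.1) :
    (CatRing.grading C).one p.1 * CatRing.of p f = CatRing.of p f :=
  (CatRing.grading C).one_mul (a := p.1) (b := p.2) ⟨f, rfl⟩

theorem CatRing.of_mul_one_of_ne {p : C × C} {b : C} (h : p.2 ≠ b) (f : p.2 ⟶ p.1) :
    CatRing.of p f * (CatRing.grading C).one b = 0 :=
  CatRing.of_mul_of_ne (p := p) (q := (b, b)) h f (𝟙 b)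

theorem CatRing.one_mul_of_of_ne {p : C × C} {a : C} (h : a ≠ p.1) (f : p.2 ⟶ p.1) :
    (CatRing.grading C).one a * CatRing.of p f = 0 :=
  CatRing.of_mul_of_ne (p := (a, a)) (q := p) h (𝟙 a) f

theorem CatRing.one_mul_mul_one (a b : C) (r : CatRing C) :
    (CatRing.grading C).one a * r * (CatRing.grading C).one b =
      CatRing.of (a, b) (CatRing.proj (a, b) r) := by
  induction r using CatRing.induction with
  | zero => simp
  | of q f =>
    obtain ⟨c, d⟩ := q
    by_cases h : (a, b) = (c, d)
    · obtain ⟨rfl, rfl⟩ := Prod.mk.inj h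
      rw [CatRing.proj_of, CatRing.one_mul_of (a, b), CatRing.of_mul_one (a, b)]
    · rw [CatRing.proj_of_ne h, map_zero]
      by_cases h1 : a = c
      · subst h1
        rw [CatRing.one_mul_of (a, d),
          CatRing.of_mul_one_of_ne (p := (a, d)) fun h2 => h (by rw [← h2])]
      · rw [CatRing.one_mul_of_of_ne (p := (c, d)) h1, zero_mul]
  | add r s hr hs => rw [mul_add, add_mul, hr, hs, map_add, map_add]

theorem CatRing.exists_sum_mul_one (r : CatRing C) :
    ∃ U : Finset C, ∀ V, U ⊆ V → ∑ b ∈ V, r * (CatRing.grading C).one b = r := by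
  classical
  induction r using CatRing.induction with
  | zero => exact ⟨∅, by simp⟩
  | of q f =>
    refine ⟨{q.2}, fun V hV => ?_⟩
    rw [Finset.sum_eq_single_of_mem q.2 (hV (Finset.mem_singleton_self _))]
    · exact CatRing.of_mul_one q f
    · intro b _ hb
      exact CatRing.of_mul_one_of_ne hb.symm f
  | add r s hr hs =>
    obtain ⟨U, hU⟩ := hr
    obtain ⟨U', hU'⟩ := hs
    refine ⟨U ∪ U', fun V hV => ?_⟩
    simp only [add_mul, Finset.sum_add_distrib]
    rw [hU V (Finset.union_subset_left hV), hU' V (Finset.union_subset_right hV)]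

theorem CatRing.eq_zero_of_mul_one (r : CatRing C)
    (h : ∀ b, r * (CatRing.grading C).one b = 0) : r = 0 := by
  obtain ⟨U, hU⟩ := CatRing.exists_sum_mul_one r
  rw [← hU U subset_rfl]
  exact Finset.sum_eq_zero fun b _ => h b

variable {M : Type u} [AddCommGroup M] [RightModule (CatRing C) M] {𝓜 : C × C → AddSubgroup M}

/-- An element of `M R` is fixed by the sum of the local units over any large enough finite set of
objects. Of these units, only the one at `b` does not kill `m`. -/
theorem act_one_of_isUnital (hM : IsUnital (CatRing C) M)
    (h : (CatRing.grading C).IsGradedModule 𝓜) {a b : C} {m : M} (hm : m ∈ 𝓜 (a, b)) :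
    act m ((CatRing.grading C).one b) = m := by
  classical
  have key : ∀ m : M, ∃ U : Finset C, ∀ V, U ⊆ V →
      ∑ b ∈ V, act m ((CatRing.grading C).one b) = m := by
    intro m
    have hm : m ∈ AddSubgroup.closure {x : M | ∃ (m : M) (r : CatRing C), x = act m r} := by
      rw [show _ = _ from hM]
      trivial
    induction hm using AddSubgroup.closure_induction with
    | mem x hx =>
      obtain ⟨m, r, rfl⟩ := hx
      obtain ⟨U, hU⟩ := CatRing.exists_sum_mul_one r
      refine ⟨U, fun V hV => ?_⟩
      simp_rw [← act_mul]
      rw [← map_sum, hU V hV]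
    | zero => exact ⟨∅, by simp⟩
    | add a b _ _ ha hb =>
      obtain ⟨T, hT⟩ := ha
      obtain ⟨T', hT'⟩ := hb
      refine ⟨T ∪ T', fun U hU => ?_⟩
      simp only [map_add, AddMonoidHom.add_apply, Finset.sum_add_distrib]
      rw [hT U (Finset.union_subset_left hU), hT' U (Finset.union_subset_right hU)]
    | neg a _ ha =>
      obtain ⟨T, hT⟩ := ha
      refine ⟨T, fun U hU => ?_⟩
      simp only [map_neg, AddMonoidHom.neg_apply, Finset.sum_neg_distrib]
      rw [hT U hU]
  obtain ⟨U, hU⟩ := key m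
  have h1 := hU (insert b U) (Finset.subset_insert _ _)
  rwa [Finset.sum_eq_single_of_mem b (Finset.mem_insert_self _ _)] at h1
  intro c _ hc
  exact h.act_eq_zero hm ((CatRing.grading C).one_mem c) hc.symm

/-- The functor `b ↦ M_(a, b)` of a graded module. -/
def gradedFunctor (hM : IsUnital (CatRing C) M) (h : (CatRing.grading C).IsGradedModule 𝓜) (a : C) :
    Cᵒᵖ ⥤ AddCommGrpCat.{u} where
  obj X := AddCommGrpCat.of (𝓜 (a, X.unop))
  map {X Y} f := AddCommGrpCat.ofHom (AddMonoidHom.mk'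
    (fun m => (⟨act m.1 (CatRing.of (X.unop, Y.unop) f.unop), h.act_mem m.2 ⟨_, rfl⟩⟩ :
      𝓜 (a, Y.unop))) fun m m' => Subtype.ext (by simp))
  map_id X := by
    ext m
    exact act_one_of_isUnital hM h m.2
  map_comp {X Y Z} f g := by
    ext m
    change act m.1 (CatRing.of (X.unop, Z.unop) (g.unop ≫ f.unop)) =
      act (act m.1 (CatRing.of (X.unop, Y.unop) f.unop)) (CatRing.of (Y.unop, Z.unop) g.unop)
    rw [← act_mul, CatRing.of_mul_of]

instance (hM : IsUnital (CatRing C) M) (h : (CatRing.grading C).IsGradedModule 𝓜) (a : C) :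
    (gradedFunctor hM h a).Additive where
  map_add {X Y f g} := by
    ext m
    refine Subtype.ext ?_
    change act m.1 (CatRing.of (X.unop, Y.unop) (f.unop + g.unop)) =
      act m.1 (CatRing.of (X.unop, Y.unop) f.unop) + act m.1 (CatRing.of (X.unop, Y.unop) g.unop)
    rw [map_add, map_add]

theorem IsFunctorBasis.eq_zero_of_sum {D : Type u} [Category.{u} D] [Preadditive D]
    {F : D ⥤ AddCommGrpCat.{u}} [F.Additive] {I : Type*} {A : I → D}
    {x : ∀ i, F.obj (A i)} (h : IsFunctorBasis F A x) {X : D} (s : Finset I) (f : ∀ i, A i ⟶ X)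
    (hf : ∑ i ∈ s, F.map (f i) (x i) = 0) {i : I} (hi : i ∈ s) : f i = 0 := by
  classical
  obtain ⟨l, -, hl⟩ := h X 0
  have e1 := hl 0 (by simp)
  have e2 := hl (DFinsupp.mk s fun i => f i) (by
    beta_reduce
    rw [finsum_map_eq_sum F A x _ s, ← hf]
    · refine Finset.sum_congr rfl fun i hi => ?_
      rw [DFinsupp.mk_of_mem hi]
    · intro i hi
      by_contra h
      exact hi (DFinsupp.mk_of_notMem h))
  rw [← e1] at e2
  have := DFunLike.congr_fun e2 i
  rwa [DFinsupp.mk_of_mem hi] at this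

theorem sum_filter_eq_zero_of_isInternal {X M : Type*} [AddCommGroup M] [DecidableEq X]
    {𝓜 : X → AddSubgroup M}
    (h : DirectSum.IsInternal 𝓜) {I : Type*} (s : Finset I) (γ : I → X) (t : I → M)
    (ht : ∀ i, t i ∈ 𝓜 (γ i)) (hs : ∑ i ∈ s, t i = 0) (p : X) :
    ∑ i ∈ s with γ i = p, t i = 0 := by
  have h0 : ∑ i ∈ s, DirectSum.of (fun p => 𝓜 p) (γ i) ⟨t i, ht i⟩ = 0 := by
    apply h.1
    simpa using hs
  let E : DirectSum X (fun p => 𝓜 p) →+ M := (𝓜 p).subtype.comp (DFinsupp.evalAddMonoidHom p)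
  have hE : ∀ i, E (DirectSum.of (fun p => 𝓜 p) (γ i) ⟨t i, ht i⟩) =
      if γ i = p then t i else 0 := fun i =>
    (DirectSum.coe_of_apply (γ i) p ⟨t i, ht i⟩).trans (by split_ifs <;> rfl)
  have h1 := congrArg E h0
  simp only [map_sum, hE, map_zero] at h1
  rwa [Finset.sum_filter]

/-- The pseudo-basis is the union over `a` of bases of the row functors `b ↦ M_(a, b)`. -/
theorem isPfm_of_forall_isFreeFunctor
    (hfree : ∀ F : Cᵒᵖ ⥤ AddCommGrpCat.{u}, F.Additive → IsFreeFunctor F) :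
    (CatRing.grading C).IsPfm := by
  classical
  intro M _ _ 𝓜 hM h
  choose I A x hx using fun a => hfree (gradedFunctor hM h a) inferInstance
  let y : ∀ i : Σ a, I a, 𝓜 (i.1, (A i.1 i.2).unop) := fun i => x i.1 i.2
  refine ⟨Σ a, I a, fun i => (i.1, (A i.1 i.2).unop), fun i => (y i).1, fun i => (y i).2, ?_, ?_⟩
  · intro N hN hxN
    have key : ∀ p, ∀ m ∈ 𝓜 p, m ∈ N := ?_
    · refine eq_top_iff.2 fun m _ => ?_
      obtain ⟨z, rfl⟩ := h.isInternal.2 m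
      induction z using DirectSum.induction_on with
      | zero => simp
      | of p m => simpa using key p m m.2
      | add z w hz hw => simpa using add_mem (hz trivial) (hw trivial)
    rintro ⟨a, b⟩ m hm
    obtain ⟨l, hl, -⟩ := hx a (Opposite.op b) (⟨m, hm⟩ : 𝓜 (a, b))
    rw [finsum_map_eq_sum _ _ _ l l.support (by simp)] at hl
    let f : I a → 𝓜 (a, b) := fun i => (gradedFunctor hM h a).map (l i) (x a i)
    have h1 : m = ((∑ i ∈ l.support, f i : 𝓜 (a, b)) : M) := congrArg Subtype.val hl
    rw [h1, AddSubgroup.val_finsetSum]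
    refine sum_mem fun i _ => ?_
    exact hN _ (hxN ⟨⟨a, i⟩, rfl⟩) _
  · intro r hr hsum
    -- Since `r i` begins with the local unit of its degree, multiplying it by the unit at `d`
    -- leaves one homogeneous component, that is, one morphism.
    have hr1 : ∀ (i : Σ a, I a) d, r i * (CatRing.grading C).one d =
        CatRing.of ((A i.1 i.2).unop, d) (CatRing.proj ((A i.1 i.2).unop, d) (r i)) := by
      intro i d
      obtain ⟨s, hs⟩ := hr i
      have h1 : r i = (CatRing.grading C).one (A i.1 i.2).unop * r i := by
        rw [hs, ← mul_assoc]
        congr 1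
        exact ((CatRing.grading C).one_mul ((CatRing.grading C).one_mem _)).symm
      rw [← CatRing.one_mul_mul_one, ← h1]
    ext1 i
    rw [Finsupp.coe_zero, Pi.zero_apply]
    refine CatRing.eq_zero_of_mul_one _ fun d => ?_
    rw [hr1]
    by_cases hi : r i = 0
    · rw [hi, map_zero, map_zero]
    have h1 : ∑ k ∈ r.support, act (y k).1
        (CatRing.of ((A k.1 k.2).unop, d) (CatRing.proj ((A k.1 k.2).unop, d) (r k))) = 0 := by
      have h2 := congrArg (fun m => act m ((CatRing.grading C).one d)) hsum
      simp only [Finsupp.sum, map_sum, AddMonoidHom.finsetSum_apply, ← act_mul, hr1, map_zero,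
        AddMonoidHom.zero_apply] at h2
      exact h2
    -- After multiplication by the unit at `d`, the component of degree `(i.1, d)` keeps just the
    -- terms of one row, which is a relation in the free functor of that row.
    have h2 := sum_filter_eq_zero_of_isInternal h.isInternal r.support
      (fun k => (k.1, d)) _ (fun k => h.act_mem (y k).2 ⟨_, rfl⟩) h1 (i.1, d)
    obtain ⟨a, i⟩ := i
    have h3 : ∑ k ∈ r.support.preimage (Sigma.mk a) sigma_mk_injective.injOn,
        (gradedFunctor hM h a).map (Y := Opposite.op d)
          (CatRing.proj ((A a k).unop, d) (r ⟨a, k⟩)).op (x a k) = 0 := by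
      refine Subtype.ext (Eq.trans ?_ h2)
      let f : I a → 𝓜 (a, d) := fun k => (gradedFunctor hM h a).map (Y := Opposite.op d)
          (CatRing.proj ((A a k).unop, d) (r ⟨a, k⟩)).op (x a k)
      change ((∑ k ∈ _, f k : 𝓜 (a, d)) : M) = _
      rw [AddSubgroup.val_finsetSum]
      refine Finset.sum_bij (fun k _ => ⟨a, k⟩) ?_ ?_ ?_ ?_
      · intro k hk
        simpa using hk
      · intro k _ k' _ hkk
        exact sigma_mk_injective hkk
      · rintro ⟨b, k⟩ hk
        simp only [Finset.mem_filter, Prod.mk.injEq, and_true] at hk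
        obtain ⟨hk, rfl⟩ := hk
        exact ⟨k, by simpa using hk, rfl⟩
      · intro k _
        rfl
    have h4 := (hx a).eq_zero_of_sum _ _ h3 (i := i) (by simpa using hi)
    have h5 : CatRing.proj ((A a i).unop, d) (r ⟨a, i⟩) = 0 := congrArg Quiver.Hom.unop h4
    rw [h5, map_zero]

end GradedToFunctor

/-! ### From contravariant functors to graded modules -/

section FunctorToGraded

variable {C : Type u} [SmallCategory C]

/-- The graded module `⨁ (A, B), F B` of a contravariant functor. -/
def FunctorSum (F : Cᵒᵖ ⥤ AddCommGrpCat.{u}) : Type u :=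
  DirectSum (C × C) fun p => F.obj (Opposite.op p.2)

namespace FunctorSum

variable (F : Cᵒᵖ ⥤ AddCommGrpCat.{u})

instance : AddCommGroup (FunctorSum F) :=
  inferInstanceAs (AddCommGroup (DirectSum (C × C) fun p => F.obj (Opposite.op p.2)))

open scoped Classical in
/-- The inclusion of a component. -/
def of (p : C × C) : F.obj (Opposite.op p.2) →+ FunctorSum F :=
  DirectSum.of (fun p : C × C => F.obj (Opposite.op p.2)) p

/-- The projection on a component. -/
def proj (p : C × C) : FunctorSum F →+ F.obj (Opposite.op p.2) :=
  DFinsupp.evalAddMonoidHom p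

theorem proj_of {p q : C × C} (h : p = q) (m : F.obj (Opposite.op p.2)) :
    proj F q (of F p m) = F.map (eqToHom (by rw [h])) m := by
  classical
  subst h
  rw [eqToHom_refl, F.map_id, ConcreteCategory.id_apply]
  exact DirectSum.of_eq_same _ _

theorem proj_of_ne {p q : C × C} (h : p ≠ q) (m : F.obj (Opposite.op p.2)) :
    proj F q (of F p m) = 0 := by
  classical
  exact DirectSum.of_eq_of_ne _ _ _ h.symm

open scoped Classical in
/-- Additive maps are given on components. -/
def lift {G : Type*} [AddCommMonoid G] (φ : ∀ p : C × C, F.obj (Opposite.op p.2) →+ G) :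
    FunctorSum F →+ G :=
  DirectSum.toAddMonoid φ

@[simp]
theorem lift_of {G : Type*} [AddCommMonoid G] (φ : ∀ p : C × C, F.obj (Opposite.op p.2) →+ G)
    (p : C × C) (m : F.obj (Opposite.op p.2)) : lift F φ (of F p m) = φ p m := by
  classical exact DirectSum.toAddMonoid_of φ p m

variable {F} in
theorem hom_ext {G : Type*} [AddCommMonoid G] {φ ψ : FunctorSum F →+ G}
    (h : ∀ p m, φ (of F p m) = ψ (of F p m)) : φ = ψ := by
  classical exact DirectSum.addHom_ext h

variable [Preadditive C] [F.Additive]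

theorem map_add_op {X Y : C} (f g : X ⟶ Y) (m : F.obj (Opposite.op Y)) :
    F.map (f + g).op m = F.map f.op m + F.map g.op m := by
  rw [op_add, F.map_add]
  rfl

open scoped Classical in
/-- The action of homogeneous elements. -/
def actHomog (p q : C × C) : F.obj (Opposite.op p.2) →+ (q.2 ⟶ q.1) →+ FunctorSum F :=
  if h : q.1 = p.2 then
    AddMonoidHom.mk' (fun m => AddMonoidHom.mk'
      (fun g => of F (p.1, q.2) (F.map (g ≫ eqToHom h).op m))
      (by
        intro a b
        rw [Preadditive.add_comp, map_add_op, map_add]))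
      (by
        intro a b
        ext g
        simp)
  else 0

/-- The action of `R[C]`. -/
def actHom : FunctorSum F →+ CatRing C →+ FunctorSum F :=
  lift F fun p => (CatRing.lift fun q => (actHomog F p q).flip).flip

theorem actHom_of_eq {p q : C × C} (h : q.1 = p.2) (m : F.obj (Opposite.op p.2))
    (g : q.2 ⟶ q.1) :
    actHom F (of F p m) (CatRing.of q g) = of F (p.1, q.2) (F.map (g ≫ eqToHom h).op m) := by
  simp [actHom, actHomog, h]

theorem actHom_of {a b d : C} (m : F.obj (Opposite.op b)) (g : d ⟶ b) :
    actHom F (of F (a, b) m) (CatRing.of (b, d) g) = of F (a, d) (F.map g.op m) :=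
  (actHom_of_eq F (p := (a, b)) (q := (b, d)) rfl m g).trans
    (congrArg (fun g : d ⟶ b => of F (a, d) (F.map g.op m)) (Category.comp_id g))

theorem actHom_of_ne {p q : C × C} (h : p.2 ≠ q.1) (m : F.obj (Opposite.op p.2)) (g : q.2 ⟶ q.1) :
    actHom F (of F p m) (CatRing.of q g) = 0 := by
  simp [actHom, actHomog, h.symm]

theorem actHom_mul_of (p q r : C × C) (m : F.obj (Opposite.op p.2)) (g : q.2 ⟶ q.1)
    (h : r.2 ⟶ r.1) :
    actHom F (of F p m) (CatRing.of q g * CatRing.of r h) =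
      actHom F (actHom F (of F p m) (CatRing.of q g)) (CatRing.of r h) := by
  obtain ⟨a, b⟩ := p
  obtain ⟨c, d⟩ := q
  obtain ⟨e, k⟩ := r
  by_cases h1 : b = c
  · subst h1
    have e1 : actHom F (of F (a, b) m) (CatRing.of (b, d) g) = of F (a, d) (F.map g.op m) :=
      actHom_of F m g
    by_cases h2 : d = e
    · subst h2
      have e2 : CatRing.of (b, d) g * CatRing.of (d, k) h = CatRing.of (b, k) (h ≫ g) :=
        CatRing.of_mul_of g h
      have e3 : actHom F (of F (a, b) m) (CatRing.of (b, k) (h ≫ g)) =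
        of F (a, k) (F.map (h ≫ g).op m) := actHom_of F m (h ≫ g)
      have e4 : actHom F (of F (a, d) (F.map g.op m)) (CatRing.of (d, k) h) =
        of F (a, k) (F.map h.op (F.map g.op m)) := actHom_of F _ h
      rw [e1, e2, e3, e4, op_comp, F.map_comp, ConcreteCategory.comp_apply]
    · rw [e1, CatRing.of_mul_of_ne (p := (b, d)) h2, actHom_of_ne F (p := (a, d)) h2, map_zero]
  · rw [actHom_of_ne F (p := (a, b)) (q := (c, d)) h1, map_zero, AddMonoidHom.zero_apply]
    by_cases h2 : d = e
    · subst h2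
      have e1 : CatRing.of (c, d) g * CatRing.of (d, k) h = CatRing.of (c, k) (h ≫ g) :=
        CatRing.of_mul_of g h
      rw [e1, actHom_of_ne F (p := (a, b)) (q := (c, k)) h1]
    · rw [CatRing.of_mul_of_ne (p := (c, d)) h2, map_zero]

instance : RightModule (CatRing C) (FunctorSum F) where
  act := actHom F
  act_mul m r s := by
    induction r using CatRing.induction with
    | zero => simp
    | add r r' hr hr' => simp [add_mul, hr, hr']
    | of q g =>
      induction s using CatRing.induction with
      | zero => simp
      | add s s' hs hs' => simp [mul_add, hs, hs']
      | of r h =>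
        have key : (actHom F).flip (CatRing.of q g * CatRing.of r h) =
            ((actHom F).flip (CatRing.of r h)).comp ((actHom F).flip (CatRing.of q g)) :=
          hom_ext fun p m => actHom_mul_of F p q r m g h
        exact DFunLike.congr_fun key m

theorem act_of {a b d : C} (m : F.obj (Opposite.op b)) (g : d ⟶ b) :
    act (of F (a, b) m) (CatRing.of (b, d) g) = of F (a, d) (F.map g.op m) := actHom_of F m g

theorem act_of_ne {p q : C × C} (h : p.2 ≠ q.1) (m : F.obj (Opposite.op p.2)) (g : q.2 ⟶ q.1) :
    act (of F p m) (CatRing.of q g) = 0 := actHom_of_ne F h m g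

theorem isUnital : IsUnital (CatRing C) (FunctorSum F) := by
  classical
  refine eq_top_iff.2 fun m _ => ?_
  induction m using DirectSum.induction_on with
  | zero => exact zero_mem _
  | add a b ha hb => exact add_mem (ha trivial) (hb trivial)
  | of p m =>
    refine AddSubgroup.subset_closure ⟨of F p m, CatRing.of (p.2, p.2) (𝟙 p.2), ?_⟩
    refine Eq.trans ?_ (act_of F (a := p.1) m (𝟙 p.2)).symm
    rw [op_id, F.map_id, ConcreteCategory.id_apply]
    rfl

theorem isGradedModule :
    (CatRing.grading C).IsGradedModule fun p => (of F p).range where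
  isInternal := by
    classical
    let ψ : FunctorSum F →+ DirectSum (C × C) fun p => (of F p).range :=
      lift F fun p => (DirectSum.of (fun p : C × C => (of F p).range) p).comp
        (of F p).rangeRestrict
    have h1 : (DirectSum.coeAddMonoidHom fun p : C × C => (of F p).range).comp ψ =
        AddMonoidHom.id _ := by
      refine hom_ext fun p f => ?_
      simp only [ψ, AddMonoidHom.comp_apply, lift_of]
      exact DirectSum.coeAddMonoidHom_of _ p _
    have h2 : ψ.comp (DirectSum.coeAddMonoidHom fun p : C × C => (of F p).range) =
        AddMonoidHom.id _ := by
      refine DirectSum.addHom_ext fun p y => ?_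
      obtain ⟨_, f, rfl⟩ := y
      rw [AddMonoidHom.comp_apply, DirectSum.coeAddMonoidHom_of]
      exact lift_of F _ p f
    exact ⟨Function.LeftInverse.injective (g := ψ) fun y => DFunLike.congr_fun h2 y,
      Function.RightInverse.surjective (g := ψ) fun y => DFunLike.congr_fun h1 y⟩
  act_mem := by
    rintro a b d _ _ ⟨m, rfl⟩ ⟨g, rfl⟩
    exact ⟨F.map g.op m, (act_of F m g).symm⟩
  act_eq_zero := by
    rintro a b c d _ _ ⟨m, rfl⟩ ⟨g, rfl⟩ h
    exact act_of_ne F (p := (a, b)) (q := (c, d)) h m g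

/-- Acting by a morphism preserves the row: entry `(a, d)` of the product depends only on row `a` of
`m`. The two cases avoid transporting `g` along an equality of objects that may fail. -/
theorem proj_act (a b c d : C) (m : FunctorSum F) (g : c ⟶ b) :
    (∃ h : c = d, proj F (a, d) (act m (CatRing.of (b, c) g)) =
      F.map (eqToHom h.symm ≫ g).op (proj F (a, b) m)) ∨
      proj F (a, d) (act m (CatRing.of (b, c) g)) = 0 := by
  by_cases h : c = d
  · subst h
    refine Or.inl ⟨rfl, ?_⟩
    rw [eqToHom_refl, Category.id_comp]
    have key : (proj F (a, c)).comp ((actHom F).flip (CatRing.of (b, c) g)) =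
        (F.map g.op).hom.comp (proj F (a, b)) := by
      refine hom_ext fun p m => ?_
      obtain ⟨a', b'⟩ := p
      by_cases hb : b' = b
      · subst hb
        have e1 : actHom F (of F (a', b') m) (CatRing.of (b', c) g) = of F (a', c) (F.map g.op m) :=
          actHom_of F m g
        rw [AddMonoidHom.comp_apply, AddMonoidHom.flip_apply, e1, AddMonoidHom.comp_apply]
        by_cases ha : a' = a
        · subst ha
          rw [proj_of F rfl, proj_of F rfl]
          simp
        · rw [proj_of_ne F fun h => ha (congrArg Prod.fst h),
            proj_of_ne F fun h => ha (congrArg Prod.fst h), map_zero]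
      · rw [AddMonoidHom.comp_apply, AddMonoidHom.flip_apply,
          actHom_of_ne F (p := (a', b')) (q := (b, c)) hb, map_zero, AddMonoidHom.comp_apply,
          proj_of_ne F fun h => hb (congrArg Prod.snd h), map_zero]
    exact DFunLike.congr_fun key m
  · right
    have key : (proj F (a, d)).comp ((actHom F).flip (CatRing.of (b, c) g)) = 0 := by
      refine hom_ext fun p m => ?_
      obtain ⟨a', b'⟩ := p
      by_cases hb : b' = b
      · subst hb
        have e1 : actHom F (of F (a', b') m) (CatRing.of (b', c) g) = of F (a', c) (F.map g.op m) :=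
          actHom_of F m g
        rw [AddMonoidHom.comp_apply, AddMonoidHom.flip_apply, e1,
          proj_of_ne F fun h' => h (congrArg Prod.snd h')]
        rfl
      · rw [AddMonoidHom.comp_apply, AddMonoidHom.flip_apply,
          actHom_of_ne F (p := (a', b')) (q := (b, c)) hb, map_zero]
        rfl
    exact DFunLike.congr_fun key m

end FunctorSum

/-- All rows of `FunctorSum F` are copies of `F`, and the action does not mix rows. So the members
of a pseudo-basis that lie in one fixed row `a` form a basis of `F`. -/
theorem isFreeFunctor_of_isPfm [Preadditive C] (h : (CatRing.grading C).IsPfm) (F : Cᵒᵖ ⥤ AddCommGrpCat.{u})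
    [F.Additive] : IsFreeFunctor F := by
  classical
  rcases isEmpty_or_nonempty C with hC | ⟨⟨a⟩⟩
  · exact ⟨PEmpty, PEmpty.elim, fun i => i.elim, fun X => isEmptyElim X.unop⟩
  obtain ⟨I, γ, x, hx, hgen, hind⟩ := h (FunctorSum F) _ (FunctorSum.isUnital F)
    (FunctorSum.isGradedModule F)
  choose y hy using hx
  let A : {i // (γ i).1 = a} → Cᵒᵖ := fun i => Opposite.op (γ i.1).2
  refine ⟨{i // (γ i).1 = a}, A, fun i => y i.1, isFunctorBasis_of F A _ ?_ ?_⟩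
  · intro X l hl
    let r : {i // (γ i).1 = a} → CatRing C := fun i =>
      CatRing.of ((γ i.1).2, X.unop) (l i).unop
    -- The coefficients of the relation as homogeneous ring elements, extended by zero to the
    -- pseudo-basis elements outside row `a`.
    let s : I →₀ CatRing C := ∑ i ∈ l.support, Finsupp.single i.1 (r i)
    have hs1 : ∀ i, s i = (CatRing.grading C).one (γ i).2 * s i := by
      intro i
      simp only [s, Finsupp.finsetSum_apply, Finset.mul_sum]
      refine Finset.sum_congr rfl fun k _ => ?_
      rw [Finsupp.single_apply]
      split_ifs with hk
      · subst hk
        exact (CatRing.one_mul_of ((γ k.1).2, X.unop) _).symm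
      · rw [mul_zero]
    have hsum : s.sum (fun i r => act (x i) r) = 0 := by
      have e1 : s.sum (fun i r => act (x i) r) = ∑ i ∈ l.support, act (x i.1) (r i) := by
        rw [← Finsupp.sum_finsetSum_index (fun _ => map_zero _) fun _ _ _ => map_add _ _ _]
        exact Finset.sum_congr rfl fun i _ => Finsupp.sum_single_index (map_zero _)
      have e2 : ∀ i : {i // (γ i).1 = a}, act (x i.1) (r i) =
          FunctorSum.of F (a, X.unop) (F.map (l i) (y i.1)) := by
        intro i
        rw [← hy]
        refine (FunctorSum.act_of F (a := (γ i.1).1) (y i.1) (l i).unop).trans ?_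
        have e3 : ∀ {b : C} (_ : b = a) (m : F.obj X),
          FunctorSum.of F (b, X.unop) m = FunctorSum.of F (a, X.unop) m := by
          rintro _ rfl m
          rfl
        exact e3 i.2 _
      rw [finsum_map_eq_sum F A _ l l.support (by simp)] at hl
      rw [e1, Finset.sum_congr rfl fun i _ => e2 i, ← map_sum]
      exact (congrArg _ hl).trans (map_zero _)
    have h0 := hind s (fun i => ⟨s i, hs1 i⟩) hsum
    ext i
    by_contra hi
    have h1 := DFunLike.congr_fun h0 i.1
    simp only [s, Finsupp.finsetSum_apply, Finsupp.coe_zero, Pi.zero_apply] at h1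
    rw [Finset.sum_eq_single_of_mem i (by simpa using hi), Finsupp.single_eq_same] at h1
    · have h2 := congrArg (CatRing.proj ((γ i.1).2, X.unop)) h1
      rw [CatRing.proj_of, map_zero] at h2
      exact hi (Quiver.Hom.unop_inj h2)
    · intro k _ hk
      rw [Finsupp.single_eq_of_ne fun h => hk (Subtype.ext h.symm)]
  · intro X z
    -- The elements whose entries in row `a` lie in the span of the chosen elements, with no
    -- condition on other rows. This is a submodule containing the pseudo-basis, hence everything.
    let N : AddSubgroup (FunctorSum F) := ⨅ d : C,
      (functorSpan F A (fun i => y i.1) (Opposite.op d)).comap (FunctorSum.proj F (a, d))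
    have hN : ∀ m, m ∈ N ↔ ∀ d : C,
        FunctorSum.proj F (a, d) m ∈ functorSpan F A (fun i => y i.1) (Opposite.op d) := by
      intro m
      simp only [N, AddSubgroup.mem_iInf]
      rfl
    have htop : N = ⊤ := by
      refine hgen N (fun m hm r => ?_) ?_
      · induction r using CatRing.induction with
        | zero => simp
        | add r s hr hs => simpa using add_mem hr hs
        | of q g =>
          rw [hN] at hm ⊢
          intro d
          rcases FunctorSum.proj_act F a q.1 q.2 d m g with ⟨_, he⟩ | he
          · refine (congrArg (· ∈ functorSpan F A (fun i => y i.1) (Opposite.op d)) he).mpr ?_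
            exact map_functorSpan F A _ _ (hm q.1)
          · refine (congrArg (· ∈ functorSpan F A (fun i => y i.1) (Opposite.op d)) he).mpr ?_
            exact zero_mem _
      · rintro _ ⟨i, rfl⟩
        rw [SetLike.mem_coe, hN]
        intro d
        rw [← hy]
        by_cases hi : γ i = (a, d)
        · rw [FunctorSum.proj_of F hi]
          exact map_mem_functorSpan F A (fun i => y i.1) ⟨i, congrArg Prod.fst hi⟩ _
        · rw [FunctorSum.proj_of_ne F hi]
          exact zero_mem _
    have h1 := (hN (FunctorSum.of F (a, X.unop) z)).1 (htop ▸ trivial) X.unop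
    rw [FunctorSum.proj_of F rfl, eqToHom_refl, F.map_id, ConcreteCategory.id_apply] at h1
    exact h1

end FunctorToGraded

theorem exists_isSimpleFamily_op_iff {C : Type u} [SmallCategory C] [Preadditive C] :
    (∃ (J : Type u) (A : J → Cᵒᵖ), IsSimpleFamily A) ↔
      ∃ (J : Type u) (A : J → C), IsSimpleFamily A :=
  ⟨fun ⟨_, _, hA⟩ => ⟨_, _, hA.unop⟩, fun ⟨_, _, hA⟩ => ⟨_, _, hA.op⟩⟩

end

theorem mainTheorem12 (C : Type u) [SmallCategory C] [Preadditive C]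
    (hC : (∀ A : C, IsZero A) → Subsingleton C) :
    List.TFAE [
      ∀ F : Cᵒᵖ ⥤ AddCommGrpCat.{u}, F.Additive → IsFreeFunctor F,
      ∀ F : C ⥤ AddCommGrpCat.{u}, F.Additive → IsFreeFunctor F,
      (CatRing.grading C).IsPfm,
      HasMatrixDescription C,
      ∃ (J : Type u) (D : J → Type u) (_ : ∀ j, DivisionRing (D j))
        (P : ObjectProperty (FGMod (directSumRing D))),
        (∀ j, P (FGMod.summand D j)) ∧ PreadditiveIso C P.FullSubcategory,
      ∃ (J : Type u) (D : J → Type u) (_ : ∀ j, DivisionRing (D j))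
        (P : ObjectProperty (FiniteProd fun j => FGMod (D j))),
        (∀ j, ∃ X, P X ∧ IsCopy D j X) ∧ PreadditiveIso C P.FullSubcategory] := by
  tfae_have 1 ↔ 4 := forall_isFreeFunctor_iff.trans
    (exists_isSimpleFamily_op_iff.trans hasMatrixDescription_iff.symm)
  tfae_have 2 ↔ 4 := forall_isFreeFunctor_iff.trans hasMatrixDescription_iff.symm
  tfae_have 1 → 3 := isPfm_of_forall_isFreeFunctor
  tfae_have 3 → 1 := fun h F _ => isFreeFunctor_of_isPfm h F
  tfae_have 4 → 5 := HasMatrixDescription.exists_directSumRing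
  tfae_have 5 → 4 := fun ⟨_, _, _, _, hP, h⟩ =>
    hasMatrixDescription_iff.2 (exists_isSimpleFamily_of_directSumRing hP h)
  tfae_have 4 → 6 := fun h => h.exists_finiteProd hC
  tfae_have 6 → 4 := fun ⟨_, _, _, _, hP, h⟩ =>
    hasMatrixDescription_iff.2 (exists_isSimpleFamily_of_finiteProd hP h)
  tfae_finish
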